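/- All vector spaces are over $\mathbb{Q}$. A DGL is a differential graded Lie algebra $L=(L_*,\partial)$, graded by the non-negative integers (not necessarily connected), with $\partial$ of degree $-1$; $H_*(L)$ denotes the graded Lie algebra given by the homology of its underlying chain complex, and $(H_*(L),0)$ is this Lie algebra regarded as a DGL with zero differential. Two DGLs are weakly equivalent ($\simeq$) if they are joined by a finite zigzag of quasi-isomorphisms of DGLs. $\mathrm{Ab}(L)=L/[L,L]$ is the abelianization, a chain complex. A DGL is free if it is the free DGL $\mathbb{L}(V)$ on a chain complex $V$ (equivalently, a coproduct of DGL spheres and DGL disks). A free simplicial resolution of $L$ is an augmented simplicial DGL $A_\bullet\to L$ such that each $A_n$ is free, on generating complexes that can be chosen so that the degeneracies carry generators to generators, and such that $\pi_sH_t(A_\bullet)\to\pi_sH_t(L)$ is an isomorphism for all $s,t\ge 0$, where $L$ is regarded as a constant simplicial object. The bigraded Quillen homology of $L$ is $$H_{s,t}(L):=\pi_sH_t(\mathrm{Ab}(A_\bullet)),$$ and its bigraded cohomology with coefficients in a chain complex $M$ (an abelian DGL) is $$H^s_t(L;M):=\pi^s\,[\Sigma^t\mathrm{Ab}(A_\bullet),M],$$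 where $[\Sigma^tX,M]$ denotes the vector space of chain homotopy classes of chain maps $X\to M$ of degree $t\in\mathbb{Z}$. **Proposition.** Let $L$ be any DGL, and let $L'\simeq(H_*(L),0)$ be a coformal model for $L$. Then, whichever free simplicial resolutions of $L$ and $L'$ are used to compute homology and cohomology, there is a monomorphism of bigraded vector spaces $$H_{n,t}(L)\hookrightarrow H_{n,t}(L')\qquad(n,t\ge 0),$$ and, for every chain complex $M$ of vector spaces (in particular for every graded vector space $M$ with zero differential, the case of trivial coefficients), there is a monomorphism of bigraded vector spaces $$H^n_t(L;M)\hookrightarrow H^n_t(L';M)\qquad(n\ge 0,\ t\in\mathbb{Z}).$$ -/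

import Mathlib

open CategoryTheory Opposite AlgebraicTopology
open scoped Simplicial

universe u

noncomputable section

/-- Non-negatively graded chain complexes of rational vector spaces. -/
abbrev RatComplex : Type (u + 1) := ChainComplex (ModuleCat.{u} ℚ) ℕ

/-- A differential graded Lie algebra over `ℚ`, graded by the natural numbers (not necessarily
connected).  The bracket of degrees `p`, `q` is recorded with an arbitrary target degree `r` and
is zero unless `p + q = r`, just as the differential `X.d i j` is zero unless `j + 1 = i`.
In particular `X.d p (p - 1)` is the differential out of degree `p`; it is zero for `p = 0`. -/
structure DGL : Type (u + 1) where
  X : RatComplex.{u}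
  bracket : ∀ p q r : ℕ, X.X p →ₗ[ℚ] X.X q →ₗ[ℚ] X.X r
  bracket_shape : ∀ p q r : ℕ, p + q ≠ r → bracket p q r = 0
  bracket_symm : ∀ (p q r : ℕ) (x : X.X p) (y : X.X q),
    bracket p q r x y = (-1 : ℚ) ^ (p * q + 1) • bracket q p r y x
  jacobi : ∀ (p q r : ℕ) (x : X.X p) (y : X.X q) (z : X.X r),
    (-1 : ℚ) ^ (p * r) • bracket (p + q) r (p + q + r) (bracket p q (p + q) x y) z
      + (-1 : ℚ) ^ (q * p) • bracket (q + r) p (p + q + r) (bracket q r (q + r) y z) x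
      + (-1 : ℚ) ^ (r * q) • bracket (r + p) q (p + q + r) (bracket r p (r + p) z x) y = 0
  d_bracket : ∀ (p q r : ℕ), p + q = r → ∀ (x : X.X p) (y : X.X q),
    (X.d r (r - 1)).hom (bracket p q r x y)
      = bracket (p - 1) q (r - 1) ((X.d p (p - 1)).hom x) y
        + (-1 : ℚ) ^ p • bracket p (q - 1) (r - 1) x ((X.d q (q - 1)).hom y)

namespace DGL

/-- Morphisms of DGLs: chain maps that preserve the bracket. -/
@[ext]
structure Hom (K L : DGL.{u}) : Type u where
  f : K.X ⟶ L.X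
  map_bracket : ∀ (p q r : ℕ) (x : K.X.X p) (y : K.X.X q),
    (f.f r).hom (K.bracket p q r x y) = L.bracket p q r ((f.f p).hom x) ((f.f q).hom y)

instance : Category DGL.{u} where
  Hom := Hom
  id K := ⟨𝟙 K.X, fun _ _ _ _ _ => rfl⟩
  comp F G := ⟨F.f ≫ G.f, fun p q r x y => by
    simp [F.map_bracket, G.map_bracket]⟩

/-- The underlying chain complex of a DGL. -/
def toComplex : DGL.{u} ⥤ RatComplex.{u} where
  obj K := K.X
  map F := Hom.f F

/-! ### Homology of the underlying complex, and the coformal model -/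

/-- Cycles of degree `n`. -/
def cyc (L : DGL.{u}) (n : ℕ) : Submodule ℚ (L.X.X n) :=
  LinearMap.ker (L.X.d n (n - 1)).hom

/-- Boundaries of degree `n`. -/
def bdry (L : DGL.{u}) (n : ℕ) : Submodule ℚ (L.X.X n) :=
  LinearMap.range (L.X.d (n + 1) n).hom

/-- The homology `H_n(L)` of the underlying chain complex of `L`. -/
abbrev Hmod (L : DGL.{u}) (n : ℕ) : Type u := L.cyc n ⧸ (L.bdry n).submoduleOf (L.cyc n)

lemma bracket_cyc (L : DGL.{u}) (p q r : ℕ) (x : L.cyc p) (y : L.cyc q) :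
    L.bracket p q r x y ∈ L.cyc r := by
  by_cases h : p + q = r
  · have hx : (L.X.d p (p - 1)).hom (x : L.X.X p) = 0 := x.2
    have hy : (L.X.d q (q - 1)).hom (y : L.X.X q) = 0 := y.2
    rw [cyc, LinearMap.mem_ker, L.d_bracket p q r h, hx, hy]
    simp
  · rw [L.bracket_shape p q r h]
    simp

lemma bracket_bdry_left (L : DGL.{u}) (p q r : ℕ) (x : L.X.X p) (hx : x ∈ L.bdry p)
    (y : L.cyc q) : L.bracket p q r x y ∈ L.bdry r := by
  by_cases h : p + q = r
  · obtain ⟨a, rfl⟩ := hx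
    have hy : (L.X.d q (q - 1)).hom (y : L.X.X q) = 0 := y.2
    refine ⟨L.bracket (p + 1) q (r + 1) a y, ?_⟩
    have := L.d_bracket (p + 1) q (r + 1) (by omega) a y
    rw [hy] at this
    simpa using this
  · rw [L.bracket_shape p q r h]
    simp

lemma bracket_bdry_right (L : DGL.{u}) (p q r : ℕ) (x : L.cyc p) (y : L.X.X q)
    (hy : y ∈ L.bdry q) : L.bracket p q r x y ∈ L.bdry r := by
  rw [L.bracket_symm]
  exact Submodule.smul_mem _ _ (L.bracket_bdry_left q p r y hy x)

/-- The bracket of cycles. -/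
def cycBracket (L : DGL.{u}) (p q r : ℕ) : L.cyc p →ₗ[ℚ] L.cyc q →ₗ[ℚ] L.cyc r :=
  LinearMap.mk₂ ℚ (fun x y => ⟨L.bracket p q r x y, L.bracket_cyc p q r x y⟩)
    (fun _ _ _ => by ext; simp) (fun _ _ _ => by ext; simp)
    (fun _ _ _ => by ext; simp) (fun _ _ _ => by ext; simp)

/-- The bracket of a cycle with a homology class. -/
def cycHomBracket (L : DGL.{u}) (p q r : ℕ) : L.cyc p →ₗ[ℚ] L.Hmod q →ₗ[ℚ] L.Hmod r where
  toFun x := Submodule.mapQ _ _ (L.cycBracket p q r x) (fun y hy =>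
    L.bracket_bdry_right p q r x y hy)
  map_add' x x' := by
    apply Submodule.linearMap_qext
    ext y : 1
    exact congrArg Submodule.Quotient.mk (by simp)
  map_smul' c x := by
    apply Submodule.linearMap_qext
    ext y : 1
    exact congrArg Submodule.Quotient.mk (by simp)

/-- The bracket induced on homology: `[[x], [y]] = [[x, y]]`. -/
def homBracket (L : DGL.{u}) (p q r : ℕ) : L.Hmod p →ₗ[ℚ] L.Hmod q →ₗ[ℚ] L.Hmod r :=
  Submodule.liftQ _ (L.cycHomBracket p q r) (fun x hx => by
    rw [LinearMap.mem_ker]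
    apply Submodule.linearMap_qext
    ext y
    exact (Submodule.Quotient.mk_eq_zero _).2 (L.bracket_bdry_left p q r x hx y))

lemma homBracket_mk (L : DGL.{u}) (p q r : ℕ) (x : L.cyc p) (y : L.cyc q) :
    L.homBracket p q r (Submodule.Quotient.mk x) (Submodule.Quotient.mk y)
      = Submodule.Quotient.mk (L.cycBracket p q r x y) := rfl

lemma homBracket_shape (L : DGL.{u}) (p q r : ℕ) (h : p + q ≠ r) : L.homBracket p q r = 0 := by
  apply Submodule.linearMap_qext
  ext x : 1
  apply Submodule.linearMap_qext
  ext y : 1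
  have h0 : L.cycBracket p q r x y = 0 := by
    ext
    simp [cycBracket, L.bracket_shape p q r h]
  exact (L.homBracket_mk p q r x y).trans (congrArg Submodule.Quotient.mk h0)

lemma homBracket_symm (L : DGL.{u}) (p q r : ℕ) (x : L.Hmod p) (y : L.Hmod q) :
    L.homBracket p q r x y = (-1 : ℚ) ^ (p * q + 1) • L.homBracket q p r y x := by
  obtain ⟨x, rfl⟩ := Submodule.Quotient.mk_surjective _ x
  obtain ⟨y, rfl⟩ := Submodule.Quotient.mk_surjective _ y
  rw [homBracket_mk, homBracket_mk, ← Submodule.Quotient.mk_smul]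
  congr 1
  ext
  exact L.bracket_symm p q r x y

lemma homBracket_jacobi (L : DGL.{u}) (p q r : ℕ) (x : L.Hmod p) (y : L.Hmod q) (z : L.Hmod r) :
    (-1 : ℚ) ^ (p * r) • L.homBracket (p + q) r (p + q + r) (L.homBracket p q (p + q) x y) z
      + (-1 : ℚ) ^ (q * p) • L.homBracket (q + r) p (p + q + r) (L.homBracket q r (q + r) y z) x
      + (-1 : ℚ) ^ (r * q) • L.homBracket (r + p) q (p + q + r) (L.homBracket r p (r + p) z x) y
      = 0 := by
  obtain ⟨x, rfl⟩ := Submodule.Quotient.mk_surjective _ x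
  obtain ⟨y, rfl⟩ := Submodule.Quotient.mk_surjective _ y
  obtain ⟨z, rfl⟩ := Submodule.Quotient.mk_surjective _ z
  simp only [homBracket_mk]
  rw [← Submodule.Quotient.mk_smul, ← Submodule.Quotient.mk_smul, ← Submodule.Quotient.mk_smul,
    ← Submodule.Quotient.mk_add, ← Submodule.Quotient.mk_add, Submodule.Quotient.mk_eq_zero]
  convert Submodule.zero_mem _
  ext
  exact L.jacobi p q r x y z

lemma homBracket_zero (L : DGL.{u}) (p q r : ℕ) (x : L.Hmod p) (y : L.Hmod q) :
    (0 : L.Hmod (r - 1)) = L.homBracket (p - 1) q (r - 1) 0 y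
      + (-1 : ℚ) ^ p • L.homBracket p (q - 1) (r - 1) x 0 := by
  rw [map_zero, map_zero, LinearMap.zero_apply, smul_zero, add_zero]

/-- The homology of `L` with zero differential, as a chain complex. -/
def homologyComplex (L : DGL.{u}) : RatComplex.{u} where
  X n := ModuleCat.of ℚ (L.Hmod n)
  d _ _ := 0

/-- The DGL `(H_*(L), 0)`: the homology of `L` with the induced bracket and zero differential. -/
def homologyDGL (L : DGL.{u}) : DGL.{u} where
  X := L.homologyComplex
  bracket p q r := L.homBracket p q r
  bracket_shape p q r h := L.homBracket_shape p q r h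
  bracket_symm p q r x y := L.homBracket_symm p q r x y
  jacobi p q r x y z := L.homBracket_jacobi p q r x y z
  d_bracket p q r _ x y := L.homBracket_zero p q r x y

/-- `K ≃ L`: the equivalence relation generated by quasi-isomorphisms of DGLs. -/
def WeaklyEquivalent (K L : DGL.{u}) : Prop :=
  Relation.EqvGen (fun K L : DGL.{u} => ∃ F : K ⟶ L, QuasiIso (toComplex.map F)) K L

/-! ### Abelianization -/

/-- The span of all brackets, in degree `n`; these form the ideal `[L, L]`. -/
def decomposables (L : DGL.{u}) (n : ℕ) : Submodule ℚ (L.X.X n) :=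
  Submodule.span ℚ {z | ∃ (p q : ℕ) (x : L.X.X p) (y : L.X.X q), z = L.bracket p q n x y}

lemma d_decomposables (L : DGL.{u}) (i j : ℕ) :
    L.decomposables i ≤ (L.decomposables j).comap (L.X.d i j).hom := by
  by_cases h : j + 1 = i
  · obtain rfl : j = i - 1 := by omega
    refine Submodule.span_le.2 ?_
    rintro z ⟨p, q, x, y, rfl⟩
    by_cases hpq : p + q = i
    · simp only [SetLike.mem_coe, Submodule.mem_comap]
      rw [L.d_bracket p q i hpq]
      exact add_mem (Submodule.subset_span ⟨_, _, _, _, rfl⟩)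
        (Submodule.smul_mem _ _ (Submodule.subset_span ⟨_, _, _, _, rfl⟩))
    · rw [L.bracket_shape p q i hpq]
      simp
  · rw [L.X.shape i j (by simpa using h)]
    intro z _
    simp

lemma map_decomposables {K L : DGL.{u}} (F : K ⟶ L) (n : ℕ) :
    K.decomposables n ≤ (L.decomposables n).comap ((Hom.f F).f n).hom := by
  refine Submodule.span_le.2 ?_
  rintro z ⟨p, q, x, y, rfl⟩
  simp only [SetLike.mem_coe, Submodule.mem_comap]
  rw [Hom.map_bracket F]
  exact Submodule.subset_span ⟨_, _, _, _, rfl⟩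

/-- The chain complex `L / [L, L]`. -/
def abObj (L : DGL.{u}) : RatComplex.{u} where
  X n := ModuleCat.of ℚ (L.X.X n ⧸ L.decomposables n)
  d i j := ModuleCat.ofHom (Submodule.mapQ _ _ (L.X.d i j).hom (L.d_decomposables i j))
  shape i j h := by
    ext : 1
    apply Submodule.linearMap_qext
    ext x
    simp [L.X.shape i j h]
  d_comp_d' i j k _ _ := by
    ext : 1
    apply Submodule.linearMap_qext
    ext x
    have h : (L.X.d j k).hom ((L.X.d i j).hom x) = 0 := by
      rw [← LinearMap.comp_apply, ← ModuleCat.hom_comp, L.X.d_comp_d]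
      rfl
    simp [h]

/-- The abelianization functor `Ab`, `L ↦ L / [L, L]`, from DGLs to chain complexes
(abelian DGLs, those with zero bracket, being the same as chain complexes). -/
def ab : DGL.{u} ⥤ RatComplex.{u} where
  obj L := L.abObj
  map F :=
    { f := fun n => ModuleCat.ofHom (Submodule.mapQ _ _ ((Hom.f F).f n).hom (map_decomposables F n))
      comm' := fun i j _ => by
        ext : 1
        apply Submodule.linearMap_qext
        ext x
        have h := congrArg (fun g => g.hom x) ((Hom.f F).comm i j)
        simp only [ModuleCat.hom_comp, LinearMap.comp_apply] at h
        exact congrArg Submodule.Quotient.mk h }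
  map_id L := by
    ext n : 2
    apply Submodule.linearMap_qext
    rfl
  map_comp F G := by
    ext n : 2
    apply Submodule.linearMap_qext
    rfl

/-! ### Free DGLs and free simplicial resolutions -/

/-- `ι : V ⟶ L` exhibits `L` as the free DGL `(𝕃(V), ∂)` on the chain complex `V`.  As every
complex of rational vector spaces is a direct sum of complexes `ℚ` and `ℚ ⟶ ℚ` (identity), free
DGLs in this sense are precisely the coproducts of DGL spheres and DGL disks, including disks with
boundaries identified. -/
def IsFreeOn {V : RatComplex.{u}} {L : DGL.{u}} (ι : V ⟶ toComplex.obj L) : Prop :=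
  ∀ (K : DGL.{u}) (g : V ⟶ toComplex.obj K), ∃! F : L ⟶ K, ι ≫ toComplex.map F = g

/-- A simplicial DGL is free if each `A_n` is a free DGL, on generators that can be chosen so
that all degeneracies take generators to generators. -/
def IsFreeSimplicial (A : SimplicialObject DGL.{u}) : Prop :=
  ∃ (V : ℕ → RatComplex.{u}) (ι : ∀ n, V n ⟶ toComplex.obj (A _⦋n⦌)),
    (∀ n, IsFreeOn (ι n)) ∧
    ∀ (n : ℕ) (i : Fin (n + 1)), ∃ s : V n ⟶ V (n + 1),
      ι n ≫ toComplex.map (A.σ i) = s ≫ ι (n + 1)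

end DGL

/-- `π_s H_t` of a simplicial chain complex: apply `H_t` in every simplicial dimension, and take
the `s`-th homotopy group of the resulting simplicial vector space. -/
def piH (s t : ℕ) : SimplicialObject RatComplex.{u} ⥤ ModuleCat.{u} ℚ :=
  (SimplicialObject.whiskering _ _).obj (HomologicalComplex.homologyFunctor _ _ t) ⋙
    alternatingFaceMapComplex (ModuleCat.{u} ℚ) ⋙ HomologicalComplex.homologyFunctor _ _ s

namespace DGL

/-- `ε : A ⟶ L` is a free simplicial resolution of the DGL `L` in the sense of the `E²`-model
structure: `A` is free, and `π_s H_t(A) ⟶ π_s H_t(L)` is an isomorphism for all `s`, `t`,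
where `L` is regarded as a constant simplicial DGL. -/
structure IsFreeResolution {A : SimplicialObject DGL.{u}} {L : DGL.{u}}
    (ε : A ⟶ (SimplicialObject.const DGL.{u}).obj L) : Prop where
  free : IsFreeSimplicial A
  isIso : ∀ s t : ℕ, IsIso
    ((piH s t).map (((SimplicialObject.whiskering _ _).obj toComplex).map ε))

/-- `H_{s,t} = π_s H_t(Ab A)`, computed from a free simplicial resolution `A`. -/
def bigradedHomology (A : SimplicialObject DGL.{u}) (s t : ℕ) : ModuleCat.{u} ℚ :=
  (piH s t).obj (((SimplicialObject.whiskering _ _).obj ab).obj A)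

end DGL

/-! ### Homotopy classes of maps of chain complexes, and cohomology -/

/-- Families of linear maps `X_i ⟶ M_j`. -/
abbrev HomFamily (X M : RatComplex.{u}) : Type u := ∀ i j : ℕ, X.X i →ₗ[ℚ] M.X j

/-- The part of degree `t` of the complex `Hom(X, M)`: families of maps `X_i ⟶ M_{i+t}`. -/
def homDeg (X M : RatComplex.{u}) (t : ℤ) : Submodule ℚ (HomFamily X M) where
  carrier := {f | ∀ i j : ℕ, (j : ℤ) ≠ i + t → f i j = 0}
  add_mem' hf hg i j h := by simp [hf i j h, hg i j h]
  zero_mem' _ _ _ := rfl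
  smul_mem' c f hf i j h := by simp [hf i j h]

/-- The differential `f ↦ ∂ f - (-1)^t f ∂` on the part of degree `t` of `Hom(X, M)`. -/
def homD (X M : RatComplex.{u}) (t : ℤ) : HomFamily X M →ₗ[ℚ] HomFamily X M where
  toFun f i j := (M.d (j + 1) j).hom ∘ₗ f i (j + 1)
    - ((t.negOnePow : ℤˣ) : ℤ) • (f (i - 1) j ∘ₗ (X.d i (i - 1)).hom)
  map_add' f g := by
    funext i j
    ext x
    simp
    abel
  map_smul' c f := by
    funext i j
    ext x
    simp [smul_sub, smul_comm c]

/-- Chain maps of degree `t`. -/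
def homCyc (X M : RatComplex.{u}) (t : ℤ) : Submodule ℚ (HomFamily X M) :=
  homDeg X M t ⊓ LinearMap.ker (homD X M t)

/-- Null-homotopic chain maps of degree `t`. -/
def homBdry (X M : RatComplex.{u}) (t : ℤ) : Submodule ℚ (HomFamily X M) :=
  (homDeg X M (t + 1)).map (homD X M (t + 1))

/-- Precomposition with a chain map. -/
def homPre {X Y : RatComplex.{u}} (φ : X ⟶ Y) (M : RatComplex.{u}) :
    HomFamily Y M →ₗ[ℚ] HomFamily X M where
  toFun f i j := f i j ∘ₗ (φ.f i).hom
  map_add' _ _ := rfl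
  map_smul' _ _ := rfl

lemma homPre_mem_deg {X Y : RatComplex.{u}} (φ : X ⟶ Y) (M : RatComplex.{u}) (t : ℤ)
    (f : HomFamily Y M) (hf : f ∈ homDeg Y M t) : homPre φ M f ∈ homDeg X M t := by
  intro i j h
  simp [homPre, hf i j h]

lemma homD_homPre {X Y : RatComplex.{u}} (φ : X ⟶ Y) (M : RatComplex.{u}) (t : ℤ)
    (f : HomFamily Y M) : homD X M t (homPre φ M f) = homPre φ M (homD Y M t f) := by
  funext i j
  ext x
  have h := congrArg (fun g => g.hom x) (φ.comm i (i - 1))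
  simp only [ModuleCat.hom_comp, LinearMap.comp_apply] at h
  simp [homD, homPre, h]

lemma homPre_mem_cyc {X Y : RatComplex.{u}} (φ : X ⟶ Y) (M : RatComplex.{u}) (t : ℤ) :
    homCyc Y M t ≤ (homCyc X M t).comap (homPre φ M) := by
  intro f hf
  refine ⟨homPre_mem_deg φ M t f hf.1, ?_⟩
  have h : homD Y M t f = 0 := hf.2
  change homD X M t (homPre φ M f) = 0
  rw [homD_homPre, h, map_zero]

lemma homPre_mem_bdry {X Y : RatComplex.{u}} (φ : X ⟶ Y) (M : RatComplex.{u}) (t : ℤ) :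
    homBdry Y M t ≤ (homBdry X M t).comap (homPre φ M) := by
  rintro _ ⟨h, hh, rfl⟩
  exact ⟨homPre φ M h, homPre_mem_deg φ M _ h hh, homD_homPre φ M _ h⟩

/-- The functor `X ↦ [Σ^t X, M]`: homotopy classes of chain maps `X ⟶ M` of degree `t`, that is,
the homology in degree `t` of the complex `Hom(X, M)`. -/
def hoHom (M : RatComplex.{u}) (t : ℤ) : RatComplex.{u}ᵒᵖ ⥤ ModuleCat.{u} ℚ where
  obj X := ModuleCat.of ℚ
    (homCyc X.unop M t ⧸ (homBdry X.unop M t).submoduleOf (homCyc X.unop M t))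
  map φ := ModuleCat.ofHom (Submodule.mapQ _ _
    ((homPre φ.unop M).restrict (homPre_mem_cyc φ.unop M t))
    (fun _ hf => homPre_mem_bdry φ.unop M t hf))
  map_id X := by
    ext : 1
    apply Submodule.linearMap_qext
    rfl
  map_comp φ ψ := by
    ext : 1
    apply Submodule.linearMap_qext
    rfl

/-- `H^s_t( - ; M) = π^s [Σ^t Ab(A), M]`, computed from a free simplicial resolution `A`: the
`s`-th cohomotopy group of the cosimplicial vector space `n ↦ [Σ^t Ab(A_n), M]`. -/
def DGL.bigradedCohomology (A : SimplicialObject DGL.{u}) (M : RatComplex.{u}) (s : ℕ) (t : ℤ) :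
    ModuleCat.{u} ℚ :=
  ((alternatingCofaceMapComplex (ModuleCat.{u} ℚ)).obj
    (Functor.rightOp (((SimplicialObject.whiskering _ _).obj DGL.ab).obj A) ⋙ hoHom M t)).homology s

end

-- The bigraded groups of `L` depend only on the graded Lie algebra `H_*(L)`. Since `L'` has the
-- same homology up to isomorphism, the required monomorphisms can be taken to be isomorphisms.
--
-- Over ℚ every complex splits, so a DGL map out of a free DGL on `V` is determined on homology by
-- an arbitrary linear map `H(V) → H(K)`. Existence is `IsFreeOn.exists_hom`; uniqueness is
-- `IsFreeOn.homologyDGL_hom_ext`, which uses the polynomial path object `K[t,dt]` to deform the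
-- generators onto representatives of their homology. Free DGLs, with maps of homology as morphisms,
-- form the category `FreeDGL`. Functors such as `H_t ∘ Ab` and `[Σ^t Ab(-), M]` factor through it,
-- because maps that agree on homology have abelianizations that are chain homotopic
-- (`IsFreeOn.ab_sub_mem_bdry`, `exists_nullHomotopy`).
--
-- A free resolution `A` of `L` becomes a simplicial object of `FreeDGL`. For each `Y` in `FreeDGL`,
-- the simplicial set `Hom(Y, A_•)` consists of the linear maps from the homology of the generators
-- of `Y` to `H(A_•)`. It contracts onto `Hom(H Y, H L)` because `H_t(A_•) → H_t(L)` is a resolution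
-- of vector spaces. `FreeDGL` is not additive, so the alternating complex is formed in its free
-- ℤ-linear category. There it is a resolution relative to all objects, and such resolutions of the
-- same target are homotopy equivalent (`RelativelyExact.nonempty_homotopyEquiv`). Extending an
-- invariant functor linearly carries this equivalence to the complexes that compute homology and
-- cohomology.

universe v w

noncomputable section

/-! ### Comparison of relatively exact resolutions -/

section Comparison

open Limits

universe v₁ v₂ u₁ u₂

variable {𝒜 : Type u₁} [Category.{v₁} 𝒜] [Preadditive 𝒜] {ℬ : Type u₂} [Category.{v₂} ℬ]
  [Preadditive ℬ]

/-- `q : J Q₀ ⟶ G` makes `Q` into a resolution of `G` from the point of view of the objects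
of `𝒜`. -/
structure RelativelyExact (J : 𝒜 ⥤ ℬ) {G : ℬ} (Q : ChainComplex 𝒜 ℕ) (q : J.obj (Q.X 0) ⟶ G) :
    Prop where
  zero : J.map (Q.d 1 0) ≫ q = 0
  surj : ∀ (Y : 𝒜) (g : J.obj Y ⟶ G), ∃ f : Y ⟶ Q.X 0, J.map f ≫ q = g
  exact_zero : ∀ (Y : 𝒜) (f : Y ⟶ Q.X 0), J.map f ≫ q = 0 → ∃ g : Y ⟶ Q.X 1, g ≫ Q.d 1 0 = f
  exact_succ : ∀ (n : ℕ) (Y : 𝒜) (f : Y ⟶ Q.X (n + 1)), f ≫ Q.d (n + 1) n = 0 →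
    ∃ g : Y ⟶ Q.X (n + 2), g ≫ Q.d (n + 2) (n + 1) = f

namespace RelativelyExact

variable {J : 𝒜 ⥤ ℬ} {G : ℬ} {P Q : ChainComplex 𝒜 ℕ}
  {p : J.obj (P.X 0) ⟶ G} {q : J.obj (Q.X 0) ⟶ G}

/-- The usual degree-by-degree lifting. No projectivity of `P` is needed, since exactness of `Q` is
tested against every object of `𝒜`, in particular against the `P.X n`. -/
lemma exists_lift (hp : J.map (P.d 1 0) ≫ p = 0) (hQ : RelativelyExact J Q q) :
    ∃ f : P ⟶ Q, J.map (f.f 0) ≫ q = p := by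
  obtain ⟨f₀, h₀⟩ := hQ.surj (P.X 0) p
  obtain ⟨f₁, h₁⟩ := hQ.exact_zero (P.X 1) (P.d 1 0 ≫ f₀) (by
    rw [J.map_comp, Category.assoc, h₀, hp])
  have step : ∀ (n : ℕ) (s : Σ' (f : P.X n ⟶ Q.X n) (f' : P.X (n + 1) ⟶ Q.X (n + 1)),
      f' ≫ Q.d (n + 1) n = P.d (n + 1) n ≫ f), ∃ f'' : P.X (n + 2) ⟶ Q.X (n + 2),
      f'' ≫ Q.d (n + 2) (n + 1) = P.d (n + 2) (n + 1) ≫ s.2.1 := by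
    rintro n ⟨f, f', w⟩
    exact hQ.exact_succ n _ _ (by simp [w])
  choose k hk using step
  refine ⟨ChainComplex.mkHom P Q f₀ f₁ h₁ (fun n s => ⟨k n s, hk n s⟩), ?_⟩
  rw [ChainComplex.mkHom_f_0, h₀]

/-- Each stage of the homotopy solves for a preimage of `f - d k`, which is a cycle by the relation
at the previous stage. -/
lemma nonempty_homotopy_zero (hQ : RelativelyExact J Q q) (f : P ⟶ Q)
    (hf : J.map (f.f 0) ≫ q = 0) : Nonempty (Homotopy f 0) := by
  obtain ⟨k₀, h₀⟩ := hQ.exact_zero _ (f.f 0) hf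
  obtain ⟨k₁, h₁⟩ := hQ.exact_succ 0 _ (f.f 1 - P.d 1 0 ≫ k₀) (by simp [h₀])
  have step : ∀ (n : ℕ) (s : Σ' (k : P.X n ⟶ Q.X (n + 1)) (k' : P.X (n + 1) ⟶ Q.X (n + 2)),
      f.f (n + 1) = P.d (n + 1) n ≫ k + k' ≫ Q.d (n + 2) (n + 1)),
      ∃ k'' : P.X (n + 2) ⟶ Q.X (n + 3),
        f.f (n + 2) = P.d (n + 2) (n + 1) ≫ s.2.1 + k'' ≫ Q.d (n + 3) (n + 2) := by
    rintro n ⟨k, k', w⟩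
    obtain ⟨k'', h''⟩ := hQ.exact_succ (n + 1) _ (f.f (n + 2) - P.d (n + 2) (n + 1) ≫ k') (by
      have w' : k' ≫ Q.d (n + 2) (n + 1) = f.f (n + 1) - P.d (n + 1) n ≫ k := by
        rw [w]; abel
      simp [w'])
    exact ⟨k'', by rw [h'']; abel⟩
  choose k hk using step
  exact ⟨Homotopy.mkInductive f k₀ h₀.symm k₁ (by rw [h₁]; abel) (fun n s => ⟨k n s, hk n s⟩)⟩

/-- Two relatively exact resolutions of the same object are homotopy equivalent. -/
theorem nonempty_homotopyEquiv [J.Additive] (hP : RelativelyExact J P p) (hQ : RelativelyExact J Q q) :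
    Nonempty (HomotopyEquiv P Q) := by
  obtain ⟨f, hf⟩ := exists_lift hP.zero hQ
  obtain ⟨g, hg⟩ := exists_lift hQ.zero hP
  obtain ⟨H⟩ := hP.nonempty_homotopy_zero (f ≫ g - 𝟙 P) (by simp [hf, hg, Preadditive.sub_comp])
  obtain ⟨K⟩ := hQ.nonempty_homotopy_zero (g ≫ f - 𝟙 Q) (by simp [hf, hg, Preadditive.sub_comp])
  exact ⟨⟨f, g, Homotopy.equivSubZero.symm H, Homotopy.equivSubZero.symm K⟩⟩

end RelativelyExact

end Comparison

/-! ### Functors between free preadditive categories -/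

namespace CategoryTheory.Free

variable {C : Type w} [Category.{v} C] {D : Type w} [Category.{v} D]

/-- Morphisms of `Free ℤ C` are formal sums, so statements about maps of Hom-sets pass to them
through `Finsupp.mapDomain`. -/
lemma comp_embedding_map {X Y Z : C} (f : Free.of ℤ X ⟶ Free.of ℤ Y) (g : Y ⟶ Z) :
    f ≫ (embedding ℤ C).map g = (Finsupp.mapDomain (· ≫ g) (f : (X ⟶ Y) →₀ ℤ) : (X ⟶ Z) →₀ ℤ) := by
  induction f using Finsupp.induction_linear with
  | zero => exact (Limits.zero_comp).trans (Finsupp.mapDomain_zero (M := ℤ)).symm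
  | add f₁ f₂ h₁ h₂ =>
    exact (Preadditive.add_comp _ _ _ _ _ _).trans
      ((congrArg₂ (· + ·) h₁ h₂).trans (Finsupp.mapDomain_add (M := ℤ)).symm)
  | single f r =>
    refine (single_comp_single ℤ C f g r 1).trans ?_
    rw [mul_one]
    exact (Finsupp.mapDomain_single (M := ℤ) (f := fun h : X ⟶ Y => h ≫ g) (a := f) (b := r)).symm

/-- The functor induced on free linear categories. -/
def mapFunctor (J : C ⥤ D) : Free ℤ C ⥤ Free ℤ D := lift ℤ (J ⋙ embedding ℤ D)

instance (J : C ⥤ D) : (mapFunctor J).Additive := lift_additive ℤ _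

lemma mapFunctor_map (J : C ⥤ D) {X Y : C} (f : Free.of ℤ X ⟶ Free.of ℤ Y) :
    (mapFunctor J).map f =
      (Finsupp.mapDomain J.map (f : (X ⟶ Y) →₀ ℤ) : (J.obj X ⟶ J.obj Y) →₀ ℤ) := by
  refine Finset.sum_congr rfl fun g _ => ?_
  exact (Finsupp.smul_single _ _ _).trans (by rw [smul_eq_mul, mul_one]; rfl)

lemma mapFunctor_map_embedding (J : C ⥤ D) {X Y : C} (f : X ⟶ Y) :
    (mapFunctor J).map ((embedding ℤ C).map f) = (embedding ℤ D).map (J.map f) :=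
  (lift_map_single ℤ (J ⋙ embedding ℤ D) f 1).trans (one_smul _ _)

end CategoryTheory.Free

/-! ### Contractible Hom-sets give relatively exact complexes -/

lemma alternatingFaceMapComplex_d_one_zero {C : Type w} [Category.{v} C] [Preadditive C]
    (X : SimplicialObject C) :
    ((alternatingFaceMapComplex C).obj X).d 1 0 = X.δ 0 - X.δ 1 := by
  rw [alternatingFaceMapComplex_obj_d, AlternatingFaceMapComplex.objD, Fin.sum_univ_two]
  simp [sub_eq_add_neg]

/-- A contraction of the augmented simplicial set `C(Y, X) ⟶ D(J Y, G)`. -/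
structure SimplicialContraction {C : Type w} [Category.{v} C] {D : Type w} [Category.{v} D]
    (J : C ⥤ D) (X : SimplicialObject C) {G : D} (ε : J.obj (X _⦋0⦌) ⟶ G) (Y : C) where
  bot : (J.obj Y ⟶ G) → (Y ⟶ X _⦋0⦌)
  h : ∀ n : ℕ, (Y ⟶ X _⦋n⦌) → (Y ⟶ X _⦋n + 1⦌)
  map_bot : ∀ g, J.map (bot g) ≫ ε = g
  h_δ_zero : ∀ n f, h n f ≫ X.δ 0 = f
  h_δ_one : ∀ f, h 0 f ≫ X.δ 1 = bot (J.map f ≫ ε)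
  h_δ_succ : ∀ n f (i : Fin (n + 2)), h (n + 1) f ≫ X.δ i.succ = h n (f ≫ X.δ i)

namespace SimplicialContraction

variable {C : Type w} [Category.{v} C] {D : Type w} [Category.{v} D]
    {J : C ⥤ D} {X : SimplicialObject C} {G : D} {ε : J.obj (X _⦋0⦌) ⟶ G}

/-- The alternating face map complex of `X` in the free linear category. -/
abbrev freeComplex (X : SimplicialObject C) : ChainComplex (Free ℤ C) ℕ :=
  (alternatingFaceMapComplex (Free ℤ C)).obj
    (((SimplicialObject.whiskering _ _).obj (Free.embedding ℤ C)).obj X)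

lemma comp_freeComplex_d {Y : C} (n : ℕ) (f : Free.of ℤ Y ⟶ (freeComplex X).X (n + 1)) :
    f ≫ (freeComplex X).d (n + 1) n = ∑ i : Fin (n + 2), (-1 : ℤ) ^ (i : ℕ) •
      (Finsupp.mapDomain (· ≫ X.δ i) (f : (Y ⟶ X _⦋n + 1⦌) →₀ ℤ) : (Y ⟶ X _⦋n⦌) →₀ ℤ) := by
  rw [alternatingFaceMapComplex_obj_d, AlternatingFaceMapComplex.objD, Preadditive.comp_sum]
  refine Finset.sum_congr rfl fun i _ => ?_
  rw [Preadditive.comp_zsmul]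
  exact congrArg _ (Free.comp_embedding_map f (X.δ i))

/-- The complex `Hom(Y, freeComplex X)` is the complex of chains on the simplicial set `Hom(Y,
X_•)`. The ℤ-linear extension of `h` satisfies `d h + h d = 1` in positive degrees, because `δ 0`
undoes `h` and the remaining faces reproduce `h d` with the opposite sign. In degree zero `d h = 1 -
bot ε`. -/
theorem relativelyExact (hε : J.map (X.δ 0) ≫ ε = J.map (X.δ 1) ≫ ε)
    (H : ∀ Y : C, SimplicialContraction J X ε Y) :
    RelativelyExact (Free.mapFunctor J) (G := Free.of ℤ G) (freeComplex X)
      ((Free.embedding ℤ D).map ε) := by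
  refine ⟨?_, fun (Y : C) (g : (J.obj Y ⟶ G) →₀ ℤ) => ?_,
    fun (Y : C) (f : (Y ⟶ X _⦋0⦌) →₀ ℤ) hf => ?_,
    fun n (Y : C) (f : (Y ⟶ X _⦋n + 1⦌) →₀ ℤ) hf => ?_⟩
  · let E := Free.embedding ℤ C
    have h : (freeComplex X).d 1 0 = E.map (X.δ 0) - E.map (X.δ 1) :=
      alternatingFaceMapComplex_d_one_zero _
    refine (congrArg (fun g => (Free.mapFunctor J).map g ≫ (Free.embedding ℤ D).map ε) h).trans ?_
    refine (congrArg (· ≫ _) (Functor.map_sub (Free.mapFunctor J)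
      (f := E.map (X.δ 0)) (g := E.map (X.δ 1)))).trans ?_
    refine (Preadditive.sub_comp _ _ _).trans (sub_eq_zero.2 ?_)
    refine (congrArg (· ≫ _) (Free.mapFunctor_map_embedding J (X.δ 0))).trans ?_
    refine Eq.trans ?_ (congrArg (· ≫ _) (Free.mapFunctor_map_embedding J (X.δ 1))).symm
    refine ((Free.embedding ℤ D).map_comp _ _).symm.trans ?_
    rw [hε, Functor.map_comp]
    rfl
  · have key : Finsupp.mapDomain (· ≫ ε) (Finsupp.mapDomain J.map
        (Finsupp.mapDomain (H Y).bot g)) = g := by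
      rw [← Finsupp.mapDomain_comp, ← Finsupp.mapDomain_comp]
      convert Finsupp.mapDomain_id
      funext f
      exact (H Y).map_bot f
    refine ⟨(Finsupp.mapDomain (H Y).bot g : (Y ⟶ X _⦋0⦌) →₀ ℤ), ?_⟩
    refine (congrArg (· ≫ (Free.embedding ℤ D).map ε) (Free.mapFunctor_map J _)).trans ?_
    exact (Free.comp_embedding_map _ ε).trans key
  · have hf' : Finsupp.mapDomain (· ≫ ε) (Finsupp.mapDomain J.map f) = 0 :=
      (Free.comp_embedding_map _ ε).symm.trans ((congrArg (· ≫ (Free.embedding ℤ D).map ε)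
        (Free.mapFunctor_map J _)).symm.trans hf)
    rw [← Finsupp.mapDomain_comp] at hf'
    refine ⟨(Finsupp.mapDomain ((H Y).h 0) f : (Y ⟶ X _⦋1⦌) →₀ ℤ), ?_⟩
    refine (comp_freeComplex_d 0 _).trans ?_
    have key : ∑ i : Fin 2, (-1 : ℤ) ^ (i : ℕ) • Finsupp.mapDomain (· ≫ X.δ i)
        (Finsupp.mapDomain ((H Y).h 0) f) = f := by
      rw [Fin.sum_univ_two, ← Finsupp.mapDomain_comp, ← Finsupp.mapDomain_comp]
      have h0 : ((fun x => x ≫ X.δ 0) ∘ (H Y).h 0) = id := funext ((H Y).h_δ_zero 0)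
      have h1 : ((fun x => x ≫ X.δ 1) ∘ (H Y).h 0) = (H Y).bot ∘ ((· ≫ ε) ∘ J.map) :=
        funext ((H Y).h_δ_one)
      rw [h0, h1, Finsupp.mapDomain_comp (f := (· ≫ ε) ∘ J.map), hf', Finsupp.mapDomain_id,
        Finsupp.mapDomain_zero]
      simp
    exact key
  · have hf' := (comp_freeComplex_d n f).symm.trans hf
    refine ⟨(Finsupp.mapDomain ((H Y).h (n + 1)) f : (Y ⟶ X _⦋n + 2⦌) →₀ ℤ), ?_⟩
    refine (comp_freeComplex_d (n + 1) _).trans ?_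
    have h1 (i : Fin (n + 2)) : Finsupp.mapDomain (· ≫ X.δ i.succ)
        (Finsupp.mapDomain ((H Y).h (n + 1)) f) =
        Finsupp.mapDomain ((H Y).h n) (Finsupp.mapDomain (· ≫ X.δ i) f) := by
      rw [← Finsupp.mapDomain_comp, ← Finsupp.mapDomain_comp]
      congr 1
      exact funext fun f => (H Y).h_δ_succ n f i
    have key : ∑ i : Fin (n + 3), (-1 : ℤ) ^ (i : ℕ) • Finsupp.mapDomain (· ≫ X.δ i)
        (Finsupp.mapDomain ((H Y).h (n + 1)) f) = f := by
      rw [Fin.sum_univ_succ, ← Finsupp.mapDomain_comp]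
      have h0 : ((fun x => x ≫ X.δ 0) ∘ (H Y).h (n + 1)) = id :=
        funext ((H Y).h_δ_zero (n + 1))
      have h2 : ∑ i : Fin (n + 2), (-1 : ℤ) ^ ((i.succ : Fin (n + 3)) : ℕ) •
          Finsupp.mapDomain (· ≫ X.δ i.succ) (Finsupp.mapDomain ((H Y).h (n + 1)) f) = 0 := by
        have h3 := congrArg (Finsupp.mapDomain.addMonoidHom (M := ℤ) ((H Y).h n)) hf'
        have h4 := congrArg (fun x => -x) ((map_sum _ _ _).symm.trans (h3.trans (map_zero _)))
        rw [neg_zero, ← Finset.sum_neg_distrib] at h4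
        refine Eq.trans (Finset.sum_congr rfl fun i _ => ?_) h4
        rw [h1, map_zsmul, Fin.val_succ, pow_succ, mul_neg_one, neg_smul]
        rfl
      rw [h2, h0, Finsupp.mapDomain_id]
      simp
    exact key

end SimplicialContraction

/-! ### Fillers and contractions in exact simplicial objects -/

section Filling

variable {C : Type w} [Category.{v} C] [Preadditive C] (X : SimplicialObject C)

/-- A compatible family of faces with the zeroth one omitted has a filler. -/
lemma SimplicialObject.exists_horn_filler (m : ℕ) {M : C} (y : Fin (m + 3) → (M ⟶ X _⦋m + 1⦌))
    (hy : ∀ i j : Fin (m + 2), i ≤ j → y j.succ ≫ X.δ i = y i.castSucc ≫ X.δ j) :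
    ∃ x : M ⟶ X _⦋m + 2⦌, ∀ j : Fin (m + 2), x ≫ X.δ j.succ = y j.succ := by
  -- Moore's argument: faces are corrected from the last one downwards, and `k` counts those already
  -- correct.
  suffices H : ∀ k : ℕ, k ≤ m + 2 → ∃ x : M ⟶ X _⦋m + 2⦌, ∀ j : Fin (m + 2),
      m + 2 ≤ (j : ℕ) + k → x ≫ X.δ j.succ = y j.succ by
    obtain ⟨x, hx⟩ := H (m + 2) le_rfl
    exact ⟨x, fun j => hx j (by omega)⟩
  intro k
  induction k with
  | zero => exact fun _ => ⟨0, fun j hj => by omega⟩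
  | succ k ih =>
    intro hk
    obtain ⟨x, hx⟩ := ih (by omega)
    obtain ⟨κ, hκ⟩ : ∃ κ : Fin (m + 2), (κ : ℕ) = m + 1 - k := ⟨⟨m + 1 - k, by omega⟩, rfl⟩
    -- Since `δ (κ+1)` is inverse to `σ κ`, adding the degenerate error repairs that face. A later
    -- face `j+1` sees only `δ j` of the error, which vanishes by compatibility.
    refine ⟨x + (y κ.succ - x ≫ X.δ κ.succ) ≫ X.σ κ, fun j hj => ?_⟩
    rw [Preadditive.add_comp, Category.assoc]
    rcases eq_or_ne j κ with rfl | hne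
    · rw [X.δ_comp_σ_succ]
      simp
    · have hlt : κ < j := by
        rw [Fin.lt_def]
        have : (j : ℕ) ≠ κ := fun h => hne (Fin.ext h)
        omega
      obtain ⟨l, rfl⟩ : ∃ l : Fin (m + 1), κ = l.castSucc :=
        ⟨⟨κ, by rw [Fin.lt_def] at hlt; omega⟩, rfl⟩
      have hle : l.succ ≤ j := by
        rw [Fin.lt_def] at hlt; rw [Fin.le_def]; simpa using hlt
      have hjx := hx j (by
        rw [Fin.lt_def] at hlt
        omega)
      rw [X.δ_comp_σ_of_gt hlt, Preadditive.sub_comp_assoc]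
      have h1 := hy l.succ j hle
      have h2 := X.δ_comp_δ hle
      rw [← Fin.succ_castSucc] at h1 h2
      rw [Category.assoc, ← h2, ← Category.assoc x, hjx, h1, sub_self, Limits.zero_comp, add_zero]

/-- In a simplicial object that is exact from the point of view of `M`, every compatible family
of faces has a filler. -/
lemma SimplicialObject.exists_filler (m : ℕ) {M : C}
    (hex : ∀ f : M ⟶ X _⦋m + 1⦌, f ≫ ((alternatingFaceMapComplex C).obj X).d (m + 1) m = 0 →
      ∃ g : M ⟶ X _⦋m + 2⦌, g ≫ ((alternatingFaceMapComplex C).obj X).d (m + 2) (m + 1) = f)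
    (y : Fin (m + 3) → (M ⟶ X _⦋m + 1⦌))
    (hy : ∀ i j : Fin (m + 2), i ≤ j → y j.succ ≫ X.δ i = y i.castSucc ≫ X.δ j) :
    ∃ x : M ⟶ X _⦋m + 2⦌, ∀ j : Fin (m + 3), x ≫ X.δ j = y j := by
  obtain ⟨x, hx⟩ := SimplicialObject.exists_horn_filler X m y hy
  -- The error in the one remaining face has all its faces zero, so it is a cycle and even a
  -- normalized one.
  have hz : ∀ i : Fin (m + 2), (y 0 - x ≫ X.δ 0) ≫ X.δ i = 0 := fun i => by
    have h1 := hy 0 i (Fin.zero_le _)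
    have h2 := X.δ_comp_δ (Fin.zero_le i)
    rw [Fin.castSucc_zero] at h1 h2
    rw [Preadditive.sub_comp, Category.assoc, ← h1, ← h2, reassoc_of% hx i, sub_self]
  -- The Dold–Kan projector replaces a bounding element `u` by one whose faces other than the zeroth
  -- vanish. It fixes the normalized error, so the boundary does not change.
  obtain ⟨π₁, π₂, hπ, hπ₁, hπ₂⟩ : ∃ (π₁ : X _⦋m + 1⦌ ⟶ X _⦋m + 1⦌) (π₂ : X _⦋m + 2⦌ ⟶ X _⦋m + 2⦌),
      π₂ ≫ AlternatingFaceMapComplex.objD X (m + 1) =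
        AlternatingFaceMapComplex.objD X (m + 1) ≫ π₁ ∧
      (∀ z : M ⟶ X _⦋m + 1⦌, (∀ i, z ≫ X.δ i = 0) → z ≫ π₁ = z) ∧
      ∀ j : Fin (m + 2), π₂ ≫ X.δ j.succ = 0 := by
    refine ⟨DoldKan.PInfty.f (m + 1), DoldKan.PInfty.f (m + 2), ?_, fun z hz => ?_, fun j => ?_⟩
    · have h := (DoldKan.PInfty : (alternatingFaceMapComplex C).obj X ⟶ _).comm (m + 2) (m + 1)
      rwa [AlternatingFaceMapComplex.obj_d_eq] at h
    · rw [DoldKan.PInfty_f]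
      exact DoldKan.HigherFacesVanish.comp_P_eq_self fun j _ => hz _
    · rw [DoldKan.PInfty_f]
      exact DoldKan.HigherFacesVanish.of_P (m + 2) (m + 1) j (by omega)
  simp only [alternatingFaceMapComplex_obj_d] at hex
  obtain ⟨u, hu⟩ := hex (y 0 - x ≫ X.δ 0) (by
    rw [AlternatingFaceMapComplex.objD, Preadditive.comp_sum]
    exact Finset.sum_eq_zero fun i _ => by rw [Preadditive.comp_zsmul, hz, smul_zero])
  have hv : ∀ j : Fin (m + 2), (u ≫ π₂) ≫ X.δ j.succ = 0 := fun j => by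
    rw [Category.assoc, hπ₂, Limits.comp_zero]
  have h0 : (u ≫ π₂) ≫ X.δ 0 = y 0 - x ≫ X.δ 0 := by
    have h : (u ≫ π₂) ≫ AlternatingFaceMapComplex.objD X (m + 1) = y 0 - x ≫ X.δ 0 := by
      rw [Category.assoc, hπ, ← Category.assoc]
      exact (congrArg (· ≫ π₁) hu).trans (hπ₁ _ hz)
    rw [← h, AlternatingFaceMapComplex.objD, Fin.sum_univ_succ, Preadditive.comp_add,
      Preadditive.comp_sum, Finset.sum_eq_zero]
    · simp
    · intro i _
      rw [Preadditive.comp_zsmul, hv, smul_zero]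
  refine ⟨x + u ≫ π₂, fun j => ?_⟩
  rw [Preadditive.add_comp]
  refine Fin.cases ?_ (fun j => ?_) j
  · rw [h0]; abel
  · rw [hv, hx, add_zero]

/-- A relatively exact augmented simplicial object has a contraction (an extra degeneracy without
the conditions on the degeneracies). -/
theorem SimplicialObject.exists_contraction {T : C} (ε : X _⦋0⦌ ⟶ T)
    (H : RelativelyExact (𝟭 C) ((alternatingFaceMapComplex C).obj X) ε) :
    ∃ (b : T ⟶ X _⦋0⦌) (h : ∀ n : ℕ, X _⦋n⦌ ⟶ X _⦋n + 1⦌), b ≫ ε = 𝟙 T ∧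
      (∀ n, h n ≫ X.δ 0 = 𝟙 _) ∧ h 0 ≫ X.δ 1 = ε ≫ b ∧
      ∀ n (i : Fin (n + 2)), h (n + 1) ≫ X.δ i.succ = X.δ i ≫ h n := by
  have hε : X.δ 0 ≫ ε = X.δ 1 ≫ ε := by
    have h : ((alternatingFaceMapComplex C).obj X).d 1 0 ≫ ε = 0 := H.zero
    rwa [alternatingFaceMapComplex_d_one_zero, Preadditive.sub_comp, sub_eq_zero] at h
  obtain ⟨b, hb⟩ : ∃ b : T ⟶ X _⦋0⦌, b ≫ ε = 𝟙 T := H.surj T (𝟙 T)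
  obtain ⟨u, hu⟩ : ∃ u : X _⦋0⦌ ⟶ X _⦋1⦌, u ≫ (X.δ 0 - X.δ 1) = 𝟙 _ - ε ≫ b := by
    rw [← alternatingFaceMapComplex_d_one_zero]
    refine H.exact_zero (X _⦋0⦌) (𝟙 (X _⦋0⦌) - ε ≫ b) ?_
    change (𝟙 (X _⦋0⦌) - ε ≫ b) ≫ ε = 0
    rw [Preadditive.sub_comp, Category.id_comp, Category.assoc, hb, Category.comp_id, sub_self]
  -- This is the compatibility of the faces `1, δ 0 ≫ h, δ 1 ≫ h, …` prescribed for the next map, so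
  -- that a filler exists.
  let Good (n : ℕ) (h : X _⦋n⦌ ⟶ X _⦋n + 1⦌) : Prop := h ≫ X.δ 0 = 𝟙 _ ∧
    ∀ i j : Fin (n + 1), i ≤ j →
      X.δ j.succ ≫ h ≫ X.δ i.succ = X.δ i.castSucc ≫ h ≫ X.δ j.succ
  have h₀ : ∃ h : X _⦋0⦌ ⟶ X _⦋1⦌, h ≫ X.δ 0 = 𝟙 _ ∧ h ≫ X.δ 1 = ε ≫ b := by
    -- The degenerate term has both faces equal to `ε b - u δ 1`. It makes the last face `ε b`
    -- without altering the difference of the two faces, which is `1 - ε b`.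
    refine ⟨u + (ε ≫ b - u ≫ X.δ 1) ≫ X.σ 0, ?_, ?_⟩
    · have h : X.σ 0 ≫ X.δ 0 = 𝟙 (X _⦋0⦌) := X.δ_comp_σ_self (i := (0 : Fin 1))
      rw [Preadditive.add_comp, Category.assoc, h, Category.comp_id]
      rw [Preadditive.comp_sub] at hu
      rw [← sub_add_cancel (u ≫ X.δ 0) (u ≫ X.δ 1), hu]
      abel
    · have h : X.σ 0 ≫ X.δ 1 = 𝟙 (X _⦋0⦌) := X.δ_comp_σ_succ (i := (0 : Fin 1))
      rw [Preadditive.add_comp, Category.assoc, h, Category.comp_id]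
      abel
  obtain ⟨h₀, h₀₀, h₀₁⟩ := h₀
  have good₀ : Good 0 h₀ := by
    refine ⟨h₀₀, fun i j _ => ?_⟩
    obtain rfl := Fin.fin_one_eq_zero i
    obtain rfl := Fin.fin_one_eq_zero j
    rw [Fin.succ_zero_eq_one, Fin.castSucc_zero, h₀₁, ← Category.assoc, ← hε, Category.assoc]
  have step : ∀ (n : ℕ) (h : {h : X _⦋n⦌ ⟶ X _⦋n + 1⦌ // Good n h}),
      ∃ h' : {h : X _⦋n + 1⦌ ⟶ X _⦋n + 2⦌ // Good (n + 1) h},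
        ∀ i : Fin (n + 2), h'.1 ≫ X.δ i.succ = X.δ i ≫ h.1 := by
    rintro n ⟨h, hh0, hh⟩
    obtain ⟨x, hx⟩ := SimplicialObject.exists_filler X n (M := X _⦋n + 1⦌)
      (fun f hf => H.exact_succ n _ f hf) (Fin.cons (𝟙 _) fun i => X.δ i ≫ h) (by
        intro i j
        refine Fin.cases (fun _ => ?_) (fun i => ?_) i
        · simp [hh0]
        · revert i
          refine Fin.cases (fun i hij => ?_) (fun j i hij => ?_) j
          · exact absurd hij (by simp)
          · have := hh i j (Fin.succ_le_succ_iff.1 hij)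
            rw [← Fin.succ_castSucc, Fin.cons_succ, Fin.cons_succ, Category.assoc,
              Category.assoc, this])
    have hx' : ∀ i : Fin (n + 2), x ≫ X.δ i.succ = X.δ i ≫ h := fun i => by
      rw [hx, Fin.cons_succ]
    refine ⟨⟨x, by rw [hx, Fin.cons_zero], fun i j hij => ?_⟩, hx'⟩
    rw [hx', hx', ← Category.assoc, ← Category.assoc, X.δ_comp_δ hij]
  choose next hnext using step
  let seq : ∀ n, {h : X _⦋n⦌ ⟶ X _⦋n + 1⦌ // Good n h} :=
    fun n => Nat.rec ⟨h₀, good₀⟩ (fun n h => next n h) n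
  exact ⟨b, fun n => (seq n).1, hb, fun n => (seq n).2.1, h₀₁, fun n i => hnext n (seq n) i⟩

end Filling

namespace DGL

/-! ### Basic constructions with DGLs -/

/-- A chain complex, as a DGL with zero bracket. -/
abbrev triv (V : RatComplex.{u}) : DGL.{u} where
  X := V
  bracket _ _ _ := 0
  bracket_shape _ _ _ _ := rfl
  bracket_symm _ _ _ _ _ := by simp
  jacobi _ _ _ _ _ _ := by simp
  d_bracket _ _ _ _ _ _ := by simp

@[ext]
lemma hom_ext {K L : DGL.{u}} {F G : K ⟶ L}
    (h : ∀ n (x : K.X.X n), ((Hom.f F).f n).hom x = ((Hom.f G).f n).hom x) : F = G := by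
  apply Hom.ext
  ext n x
  exact h n x

lemma comp_apply {K L M : DGL.{u}} (F : K ⟶ L) (G : L ⟶ M) (n : ℕ) (x : K.X.X n) :
    ((Hom.f (F ≫ G)).f n).hom x = ((Hom.f G).f n).hom (((Hom.f F).f n).hom x) := rfl

lemma map_d {K L : RatComplex.{u}} (φ : K ⟶ L) (i j : ℕ) (x : K.X i) :
    (φ.f j).hom ((K.d i j).hom x) = (L.d i j).hom ((φ.f i).hom x) :=
  (congrArg (fun g => g.hom x) (φ.comm i j)).symm

lemma d_d (K : RatComplex.{u}) (i j k : ℕ) (x : K.X i) :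
    (K.d j k).hom ((K.d i j).hom x) = 0 := by
  rw [← LinearMap.comp_apply, ← ModuleCat.hom_comp, K.d_comp_d]
  rfl

/-- The map induced on cycles by a chain map. -/
def cycMap {K L : DGL.{u}} (φ : K.X ⟶ L.X) (n : ℕ) : K.cyc n →ₗ[ℚ] L.cyc n :=
  (φ.f n).hom.restrict fun x (hx : (K.X.d n (n - 1)).hom x = 0) => by
    change (L.X.d n (n - 1)).hom _ = 0
    rw [← map_d, hx, map_zero]

/-- The homology class of a cycle. -/
def cls (K : DGL.{u}) (n : ℕ) : K.cyc n →ₗ[ℚ] K.Hmod n := Submodule.mkQ _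

lemma cls_surjective (K : DGL.{u}) (n : ℕ) : Function.Surjective (K.cls n) :=
  Submodule.mkQ_surjective _

lemma cls_eq_zero_iff (K : DGL.{u}) (n : ℕ) (x : K.cyc n) :
    K.cls n x = 0 ↔ (x : K.X.X n) ∈ K.bdry n :=
  Submodule.Quotient.mk_eq_zero _

lemma cls_eq_iff (K : DGL.{u}) (n : ℕ) (x y : K.cyc n) :
    K.cls n x = K.cls n y ↔ (x : K.X.X n) - y ∈ K.bdry n :=
  Submodule.Quotient.eq _

/-- The map induced on homology by a chain map. -/
def Hmap {K L : DGL.{u}} (φ : K.X ⟶ L.X) (n : ℕ) : K.Hmod n →ₗ[ℚ] L.Hmod n :=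
  Submodule.mapQ _ _ (cycMap φ n) (by
    rintro x ⟨y, hy⟩
    refine ⟨(φ.f (n + 1)).hom y, ?_⟩
    rw [← map_d, hy]
    rfl)

lemma Hmap_cls {K L : DGL.{u}} (φ : K.X ⟶ L.X) (n : ℕ) (x : K.cyc n) :
    Hmap φ n (K.cls n x) = L.cls n (cycMap φ n x) := rfl

lemma Hmod_ext {K : DGL.{u}} {n : ℕ} {M : Type*} [AddCommGroup M] [Module ℚ M]
    {f g : K.Hmod n →ₗ[ℚ] M} (h : ∀ x : K.cyc n, f (K.cls n x) = g (K.cls n x)) : f = g := by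
  apply Submodule.linearMap_qext
  ext x
  exact h x

/-- The functor `L ↦ (H_*(L), 0)`. -/
def homologyDGLFunctor : DGL.{u} ⥤ DGL.{u} where
  obj K := K.homologyDGL
  map {K L} F :=
    { f :=
        { f := fun n => ModuleCat.ofHom (Hmap (Hom.f F) n)
          comm' := fun _ _ _ => Limits.comp_zero.trans Limits.zero_comp.symm }
      map_bracket := fun p q r x y => by
        obtain ⟨x, rfl⟩ := K.cls_surjective p x
        obtain ⟨y, rfl⟩ := K.cls_surjective q y
        refine congrArg (L.cls r) (Subtype.ext ?_)
        exact Hom.map_bracket F p q r x y }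
  map_id K := hom_ext fun n x => by
    obtain ⟨x, rfl⟩ := K.cls_surjective n x
    rfl
  map_comp {K L M} F G := hom_ext fun n x => by
    obtain ⟨x, rfl⟩ := K.cls_surjective n x
    rfl

lemma homologyDGLFunctor_map_eq_iff {K L : DGL.{u}} (F G : K ⟶ L) :
    homologyDGLFunctor.map F = homologyDGLFunctor.map G ↔
      ∀ n, Hmap (Hom.f F) n = Hmap (Hom.f G) n := by
  constructor
  · intro h n
    refine LinearMap.ext fun x => ?_
    exact congrArg (fun F : K.homologyDGL ⟶ L.homologyDGL => ((Hom.f F).f n).hom x) h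
  · intro h
    exact hom_ext fun n x => congrArg (fun f => f x) (h n)

/-- The cycles of a DGL, as a DGL with zero differential. -/
def cyclesDGL (K : DGL.{u}) : DGL.{u} where
  X := { X := fun n => ModuleCat.of ℚ (K.cyc n), d := fun _ _ => 0 }
  bracket p q r := K.cycBracket p q r
  bracket_shape p q r h := by
    ext x y : 3
    change K.bracket p q r x y = 0
    rw [K.bracket_shape p q r h]
    rfl
  bracket_symm p q r x y := Subtype.ext (K.bracket_symm p q r x y)
  jacobi p q r x y z := Subtype.ext (K.jacobi p q r x y z)
  d_bracket p q r _ x y := by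
    change (0 : K.cyc (r - 1)) = K.cycBracket (p - 1) q (r - 1) 0 y
      + (-1 : ℚ) ^ p • K.cycBracket p (q - 1) (r - 1) x 0
    simp

/-- The inclusion of cycles. -/
def cyclesIncl (K : DGL.{u}) : K.cyclesDGL ⟶ K where
  f :=
    { f := fun n => ModuleCat.ofHom (K.cyc n).subtype
      comm' := fun i j h => by
        obtain rfl : j = i - 1 := by simp at h; omega
        ext x
        exact x.2 }
  map_bracket _ _ _ _ _ := rfl

/-- The projection from cycles to homology. -/
def cyclesProj (K : DGL.{u}) : K.cyclesDGL ⟶ K.homologyDGL where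
  f :=
    { f := fun n => ModuleCat.ofHom (K.cls n)
      comm' := fun _ _ _ => Limits.comp_zero.trans Limits.zero_comp.symm }
  map_bracket _ _ _ _ _ := rfl

/-- The projection to the abelianization. -/
def abProj (K : DGL.{u}) : K ⟶ triv (ab.obj K) where
  f :=
    { f := fun n => ModuleCat.ofHom (K.decomposables n).mkQ
      comm' := fun _ _ _ => rfl }
  map_bracket _ _ _ _ _ :=
    (Submodule.Quotient.mk_eq_zero _).2 (Submodule.subset_span ⟨_, _, _, _, rfl⟩)

/-! ### Comparison with the homology of chain complexes -/

/-- The cycles, mapped to the object of cycles. -/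
def cycToCycles (K : DGL.{u}) (n : ℕ) : ModuleCat.of ℚ (K.cyc n) ⟶ K.X.cycles n :=
  K.X.liftCycles (ModuleCat.ofHom (K.cyc n).subtype) (n - 1) (by cases n <;> simp)
    (by ext x; exact x.2)

lemma iCycles_cycToCycles (K : DGL.{u}) (n : ℕ) (x : K.cyc n) :
    (K.X.iCycles n).hom ((K.cycToCycles n).hom x) = x :=
  congrArg (fun g => g.hom x) (K.X.liftCycles_i (ModuleCat.ofHom (K.cyc n).subtype) (n - 1)
    (by cases n <;> simp) (by ext x; exact x.2))

lemma iCycles_injective (K : DGL.{u}) (n : ℕ) : Function.Injective (K.X.iCycles n).hom :=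
  (ModuleCat.mono_iff_injective (K.X.iCycles n)).1 inferInstance

/-- The class of a cycle in the homology object. -/
def cycToHomology (K : DGL.{u}) (n : ℕ) : ModuleCat.of ℚ (K.cyc n) ⟶ K.X.homology n :=
  K.cycToCycles n ≫ K.X.homologyπ n

lemma cycToHomology_surjective (K : DGL.{u}) (n : ℕ) :
    Function.Surjective (K.cycToHomology n).hom := by
  intro y
  obtain ⟨c, rfl⟩ := (ModuleCat.epi_iff_surjective (K.X.homologyπ n)).1 inferInstance y
  have hc : (K.X.iCycles n).hom c ∈ K.cyc n := by
    have h := K.X.iCycles_d n (n - 1)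
    exact congrArg (fun g => g.hom c) h
  refine ⟨⟨_, hc⟩, ?_⟩
  exact congrArg (K.X.homologyπ n).hom (K.iCycles_injective n (K.iCycles_cycToCycles n ⟨_, hc⟩))

lemma cycToHomology_eq_zero_iff (K : DGL.{u}) (n : ℕ) (x : K.cyc n) :
    (K.cycToHomology n).hom x = 0 ↔ (x : K.X.X n) ∈ K.bdry n := by
  have hex : (ShortComplex.mk _ _ (K.X.toCycles_comp_homologyπ (n + 1) n)).Exact :=
    ShortComplex.exact_of_g_is_cokernel _ (K.X.homologyIsCokernel (n + 1) n (by simp))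
  have hz : ∀ y, (K.X.homologyπ n).hom ((K.X.toCycles (n + 1) n).hom y) = 0 := fun y =>
    congrArg (fun g => g.hom y) (K.X.toCycles_comp_homologyπ (n + 1) n)
  have hi : ∀ y, (K.X.iCycles n).hom ((K.X.toCycles (n + 1) n).hom y) = (K.X.d (n + 1) n).hom y :=
    fun y => congrArg (fun g => g.hom y) (K.X.toCycles_i (n + 1) n)
  constructor
  · intro h
    obtain ⟨y, hy⟩ := (ShortComplex.moduleCat_exact_iff _).1 hex _ h
    refine ⟨y, (hi y).symm.trans ?_⟩
    exact (congrArg (K.X.iCycles n).hom hy).trans (K.iCycles_cycToCycles n x)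
  · rintro ⟨y, hy⟩
    refine Eq.trans (congrArg (K.X.homologyπ n).hom ?_) (hz y)
    apply K.iCycles_injective n
    exact (K.iCycles_cycToCycles n x).trans (hy.symm.trans (hi y).symm)

/-- The comparison map from explicit homology to the homology object. -/
def toHomology (K : DGL.{u}) (n : ℕ) : K.Hmod n →ₗ[ℚ] (K.X.homology n : Type u) :=
  Submodule.liftQ _ (K.cycToHomology n).hom fun x hx => (K.cycToHomology_eq_zero_iff n x).2 hx

lemma toHomology_bijective (K : DGL.{u}) (n : ℕ) : Function.Bijective (toHomology K n) := by
  refine ⟨(injective_iff_map_eq_zero _).2 fun x hx => ?_, fun y => ?_⟩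
  · obtain ⟨x, rfl⟩ := K.cls_surjective n x
    exact (cls_eq_zero_iff K n x).2 ((K.cycToHomology_eq_zero_iff n x).1 hx)
  · obtain ⟨x, rfl⟩ := K.cycToHomology_surjective n y
    exact ⟨K.cls n x, rfl⟩

lemma homologyMap_toHomology {K L : DGL.{u}} (φ : K.X ⟶ L.X) (n : ℕ) (x : K.Hmod n) :
    (HomologicalComplex.homologyMap φ n).hom (toHomology K n x) =
      toHomology L n (Hmap φ n x) := by
  obtain ⟨x, rfl⟩ := K.cls_surjective n x
  have h : K.cycToHomology n ≫ HomologicalComplex.homologyMap φ n =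
      ModuleCat.ofHom (cycMap φ n) ≫ L.cycToHomology n := by
    rw [cycToHomology, cycToHomology, cycToCycles, cycToCycles, Category.assoc,
      HomologicalComplex.homologyπ_naturality,
      HomologicalComplex.liftCycles_comp_cyclesMap_assoc, ← Category.assoc (ModuleCat.ofHom _),
      HomologicalComplex.comp_liftCycles]
    rfl
  exact congrArg (fun g => g.hom x) h

/-- A chain map is an isomorphism on explicit homology if and only if it is one on the homology
objects. -/
lemma isIso_homologyMap_iff {K L : DGL.{u}} (φ : K.X ⟶ L.X) (n : ℕ) :
    IsIso (HomologicalComplex.homologyMap φ n) ↔ Function.Bijective (Hmap φ n) := by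
  rw [ConcreteCategory.isIso_iff_bijective]
  have h : (HomologicalComplex.homologyMap φ n).hom ∘ toHomology K n =
      toHomology L n ∘ Hmap φ n := funext (homologyMap_toHomology φ n)
  rw [← (toHomology_bijective L n).of_comp_iff', ← h]
  exact ((toHomology_bijective K n).of_comp_iff _).symm

end DGL

/-! ### Splittings of complexes of rational vector spaces -/

/-- A pseudo-inverse: split `f` onto its range, then extend the section to the whole target. All
splittings over ℚ used below come from this. -/
lemma LinearMap.exists_comp_comp_self {k V W : Type*} [Field k] [AddCommGroup V] [Module k V]
    [AddCommGroup W] [Module k W] (f : V →ₗ[k] W) : ∃ g : W →ₗ[k] V, ∀ x, f (g (f x)) = f x := by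
  obtain ⟨s, hs⟩ := f.rangeRestrict.exists_rightInverse_of_surjective f.range_rangeRestrict
  obtain ⟨g, hg⟩ := LinearMap.exists_extend s
  refine ⟨g, fun x => ?_⟩
  have h1 : g (f x) = s (f.rangeRestrict x) := congrArg (fun t => t (f.rangeRestrict x)) hg
  have h2 : f.rangeRestrict (s (f.rangeRestrict x)) = f.rangeRestrict x :=
    congrArg (fun t => t (f.rangeRestrict x)) hs
  rw [h1]
  exact congrArg Subtype.val h2

/-- A splitting of a complex: a choice of pseudo-inverses of the differentials. -/
structure RatComplex.Splitting (V : RatComplex.{u}) where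
  h : HomFamily V V
  d_h_d : ∀ i j x, (V.d j i).hom (h i j ((V.d j i).hom x)) = (V.d j i).hom x

namespace RatComplex.Splitting

instance (V : RatComplex.{u}) : Nonempty (Splitting V) := by
  choose h hh using fun i j => LinearMap.exists_comp_comp_self (V.d j i).hom
  exact ⟨⟨h, hh⟩⟩

variable {V : RatComplex.{u}} (S : Splitting V)

/-- The component of the homotopy `∂ h + h ∂`. -/
def θ (n : ℕ) : V.X n →ₗ[ℚ] V.X n :=
  (V.d (n + 1) n).hom ∘ₗ S.h n (n + 1) + S.h (n - 1) n ∘ₗ (V.d n (n - 1)).hom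

/-- The projection `1 - ∂ h - h ∂` to a space of representatives of the homology. -/
def e (n : ℕ) : V.X n →ₗ[ℚ] V.X n := LinearMap.id - S.θ n

lemma e_apply (n : ℕ) (x : V.X n) : S.e n x = x - S.θ n x := rfl

lemma θ_apply (n : ℕ) (x : V.X n) : S.θ n x = (V.d (n + 1) n).hom (S.h n (n + 1) x)
  + S.h (n - 1) n ((V.d n (n - 1)).hom x) := rfl

/-- The identity `d h d = d` alone gives `d e = e d = 0`; no condition such as `h² = 0` is required.
-/
lemma d_e (n m : ℕ) (x : V.X n) : (V.d n m).hom (S.e n x) = 0 := by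
  by_cases h : m + 1 = n
  · obtain rfl : m = n - 1 := by omega
    rw [e_apply, θ_apply, map_sub, map_add, DGL.d_d, S.d_h_d, zero_add, sub_self]
  · rw [V.shape n m (by simpa using h)]
    rfl

lemma e_d (n m : ℕ) (x : V.X m) : S.e n ((V.d m n).hom x) = 0 := by
  by_cases h : n + 1 = m
  · subst h
    rw [e_apply, θ_apply, S.d_h_d, DGL.d_d, map_zero, add_zero, sub_self]
  · rw [V.shape m n (by simpa using h)]
    exact map_zero _

lemma e_sub_self_mem (n : ℕ) (c : (DGL.triv V).cyc n) :
    S.e n c.1 - c.1 ∈ (DGL.triv V).bdry n := by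
  have hc : (V.d n (n - 1)).hom c.1 = 0 := c.2
  rw [e_apply, θ_apply, hc, map_zero, add_zero, sub_sub_cancel_left]
  exact Submodule.neg_mem _ ⟨_, rfl⟩

/-- The projection, with values in the cycles. -/
def eCyc (n : ℕ) : V.X n →ₗ[ℚ] (DGL.triv V).cyc n :=
  (S.e n).codRestrict _ fun x => S.d_e n (n - 1) x

lemma cls_eCyc (n : ℕ) (c : (DGL.triv V).cyc n) :
    (DGL.triv V).cls n (S.eCyc n c.1) = (DGL.triv V).cls n c :=
  (DGL.cls_eq_iff _ _ _ _).2 (S.e_sub_self_mem n c)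

/-- A family of maps on `V` that factors through the projection `e` and takes values in cycles
is a chain map. -/
def chainMap {W : DGL.{u}} (g : ∀ n, (DGL.triv V).cyc n →ₗ[ℚ] W.cyc n) :
    V ⟶ W.X where
  f n := ModuleCat.ofHom ((Submodule.subtype _) ∘ₗ g n ∘ₗ S.eCyc n)
  comm' i j h := by
    obtain rfl : j = i - 1 := by simp at h; omega
    ext x
    have h1 : S.eCyc (i - 1) ((V.d i (i - 1)).hom x) = 0 := Subtype.ext (S.e_d _ _ x)
    have h2 : (W.X.d i (i - 1)).hom (g i (S.eCyc i x)).1 = 0 := (g i (S.eCyc i x)).2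
    change (W.X.d i (i - 1)).hom (g i (S.eCyc i x)).1 = (g (i - 1) (S.eCyc _ _)).1
    refine h2.trans ((congrArg (fun y => (g (i - 1) y).1) h1).trans ?_).symm
    rw [map_zero]
    rfl

end RatComplex.Splitting

/-! ### Realizing maps on homology out of a free DGL -/

namespace DGL

lemma exists_cls_section (K : DGL.{u}) (n : ℕ) :
    ∃ s : K.Hmod n →ₗ[ℚ] K.cyc n, ∀ x, K.cls n (s x) = x := by
  obtain ⟨s, hs⟩ := (K.cls n).exists_rightInverse_of_surjective
    (LinearMap.range_eq_top.2 (K.cls_surjective n))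
  exact ⟨s, fun x => congrArg (fun t => t x) hs⟩

/-- Every map from the homology of the generating complex extends to a map from the free DGL. -/
theorem IsFreeOn.exists_hom {V : RatComplex.{u}} {Y : DGL.{u}} {ι : V ⟶ Y.X}
    (hι : IsFreeOn (L := Y) ι) (Z : DGL.{u}) (l : ∀ n, (triv V).Hmod n →ₗ[ℚ] Z.Hmod n) :
    ∃ F : Y ⟶ Z, ∀ n (c : (triv V).Hmod n),
      Hmap (Hom.f F) n (Hmap (K := triv V) ι n c) = l n c := by
  obtain ⟨S⟩ := (inferInstance : Nonempty (RatComplex.Splitting V))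
  choose s hs using Z.exists_cls_section
  -- The projection `e` discards the part of `V` that is invisible in homology; `l` is then lifted
  -- to cycles of `Z` along a linear section.
  obtain ⟨F, hF, -⟩ := hι Z (S.chainMap (W := Z) fun n => s n ∘ₗ l n ∘ₗ (triv V).cls n)
  refine ⟨F, fun n c => ?_⟩
  obtain ⟨c, rfl⟩ := (triv V).cls_surjective n c
  rw [Hmap_cls, Hmap_cls, ← S.cls_eCyc n c, ← hs n (l n _)]
  refine congrArg (Z.cls n) (Subtype.ext ?_)
  exact congrArg (fun g : V ⟶ Z.X => (g.f n).hom c.1) hF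


/-! ### Extension of scalars -/

section BaseChange

open TensorProduct

variable (K : DGL.{u}) (R : Type) [CommRing R] [Algebra ℚ R]

/-- The bracket on `K ⊗ R`. -/
def tensorBracket (p q r : ℕ) : K.X.X p ⊗[ℚ] R →ₗ[ℚ] K.X.X q ⊗[ℚ] R →ₗ[ℚ] K.X.X r ⊗[ℚ] R :=
  TensorProduct.map₂ (K.bracket p q r) (LinearMap.mul ℚ R)

variable {R}

lemma tensorBracket_tmul (p q r : ℕ) (x : K.X.X p) (f : R) (y : K.X.X q) (g : R) :
    K.tensorBracket R p q r (x ⊗ₜ f) (y ⊗ₜ g) = K.bracket p q r x y ⊗ₜ[ℚ] (f * g) := rfl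

lemma tensorBracket_shape (p q r : ℕ) (h : p + q ≠ r) : K.tensorBracket R p q r = 0 := by
  apply TensorProduct.ext'
  intro x f
  apply TensorProduct.ext'
  intro y g
  rw [tensorBracket_tmul, K.bracket_shape p q r h]
  exact TensorProduct.zero_tmul _ _

lemma tensorBracket_symm (p q r : ℕ) (x : K.X.X p ⊗[ℚ] R) (y : K.X.X q ⊗[ℚ] R) :
    K.tensorBracket R p q r x y = (-1 : ℚ) ^ (p * q + 1) • K.tensorBracket R q p r y x := by
  induction x using TensorProduct.induction_on with
  | zero => simp
  | add x x' hx hx' => simp only [map_add, LinearMap.add_apply, hx, hx', smul_add]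
  | tmul x f =>
    induction y using TensorProduct.induction_on with
    | zero => simp
    | add y y' hy hy' => simp only [map_add, LinearMap.add_apply, hy, hy', smul_add]
    | tmul y g =>
      rw [tensorBracket_tmul, tensorBracket_tmul, TensorProduct.smul_tmul', ← K.bracket_symm,
        mul_comm]

lemma tensorBracket_jacobi (p q r : ℕ) (x : K.X.X p ⊗[ℚ] R) (y : K.X.X q ⊗[ℚ] R)
    (z : K.X.X r ⊗[ℚ] R) :
    (-1 : ℚ) ^ (p * r) •
        K.tensorBracket R (p + q) r (p + q + r) (K.tensorBracket R p q (p + q) x y) z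
      + (-1 : ℚ) ^ (q * p) •
        K.tensorBracket R (q + r) p (p + q + r) (K.tensorBracket R q r (q + r) y z) x
      + (-1 : ℚ) ^ (r * q) •
        K.tensorBracket R (r + p) q (p + q + r) (K.tensorBracket R r p (r + p) z x) y = 0 := by
  induction x using TensorProduct.induction_on with
  | zero => simp
  | add x x' hx hx' =>
    simp only [map_add, LinearMap.add_apply, smul_add]
    linear_combination (norm := module) hx + hx'
  | tmul x f =>
    induction y using TensorProduct.induction_on with
    | zero => simp
    | add y y' hy hy' =>
      simp only [map_add, LinearMap.add_apply, smul_add]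
      linear_combination (norm := module) hy + hy'
    | tmul y g =>
      induction z using TensorProduct.induction_on with
      | zero => simp
      | add z z' hz hz' =>
        simp only [map_add, LinearMap.add_apply, smul_add]
        linear_combination (norm := module) hz + hz'
      | tmul z h =>
        simp only [tensorBracket_tmul, TensorProduct.smul_tmul']
        rw [show g * h * f = f * g * h by ring, show h * f * g = f * g * h by ring,
          ← TensorProduct.add_tmul, ← TensorProduct.add_tmul, K.jacobi, TensorProduct.zero_tmul]

lemma tensorBracket_d (p q r : ℕ) (hr : p + q = r) (x : K.X.X p ⊗[ℚ] R) (y : K.X.X q ⊗[ℚ] R) :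
    LinearMap.rTensor R (K.X.d r (r - 1)).hom (K.tensorBracket R p q r x y)
      = K.tensorBracket R (p - 1) q (r - 1) (LinearMap.rTensor R (K.X.d p (p - 1)).hom x) y
        + (-1 : ℚ) ^ p • K.tensorBracket R p (q - 1) (r - 1) x
          (LinearMap.rTensor R (K.X.d q (q - 1)).hom y) := by
  induction x using TensorProduct.induction_on with
  | zero => simp
  | add x x' hx hx' =>
    simp only [map_add, LinearMap.add_apply, smul_add]
    rw [hx, hx']
    abel
  | tmul x f =>
    induction y using TensorProduct.induction_on with
    | zero => simp
    | add y y' hy hy' =>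
      simp only [map_add, smul_add]
      rw [hy, hy']
      abel
    | tmul y g =>
      simp only [tensorBracket_tmul, LinearMap.rTensor_tmul]
      rw [K.d_bracket p q r hr, TensorProduct.add_tmul, TensorProduct.smul_tmul']

variable (R)

/-- The DGL `K ⊗ R` over `ℚ`, for a commutative algebra `R`. -/
def baseChange : DGL.{u} where
  X :=
    { X := fun n => ModuleCat.of ℚ (K.X.X n ⊗[ℚ] R)
      d := fun i j => ModuleCat.ofHom (LinearMap.rTensor R (K.X.d i j).hom)
      shape := fun i j h => by
        rw [K.X.shape i j h, ModuleCat.hom_zero, LinearMap.rTensor_zero]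
        rfl
      d_comp_d' := fun i j k _ _ => by
        rw [← ModuleCat.ofHom_comp, ← LinearMap.rTensor_comp, ← ModuleCat.hom_comp, K.X.d_comp_d,
          ModuleCat.hom_zero, LinearMap.rTensor_zero]
        rfl }
  bracket p q r := K.tensorBracket R p q r
  bracket_shape p q r h := K.tensorBracket_shape p q r h
  bracket_symm p q r x y := K.tensorBracket_symm p q r x y
  jacobi p q r x y z := K.tensorBracket_jacobi p q r x y z
  d_bracket p q r hr x y := K.tensorBracket_d p q r hr x y

variable {R}

/-- The map `K ⊗ R ⟶ K` induced by an augmentation of `R`. -/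
def tensorEval (ev : R →ₗ[ℚ] ℚ) (n : ℕ) : K.X.X n ⊗[ℚ] R →ₗ[ℚ] K.X.X n :=
  (TensorProduct.rid ℚ (K.X.X n)).toLinearMap ∘ₗ LinearMap.lTensor _ ev

lemma tensorEval_tmul (ev : R →ₗ[ℚ] ℚ) (n : ℕ) (x : K.X.X n) (f : R) :
    K.tensorEval ev n (x ⊗ₜ f) = ev f • x := rfl

lemma tensorEval_d (ev : R →ₗ[ℚ] ℚ) (i j : ℕ) (x : K.X.X i ⊗[ℚ] R) :
    K.tensorEval ev j (LinearMap.rTensor R (K.X.d i j).hom x) =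
      (K.X.d i j).hom (K.tensorEval ev i x) := by
  induction x using TensorProduct.induction_on with
  | zero => simp
  | add x x' hx hx' => simp only [map_add, hx, hx']
  | tmul x f => rw [LinearMap.rTensor_tmul, tensorEval_tmul, tensorEval_tmul, map_smul]

lemma tensorEval_bracket (ev : R →ₐ[ℚ] ℚ) (p q r : ℕ) (x : K.X.X p ⊗[ℚ] R)
    (y : K.X.X q ⊗[ℚ] R) : K.tensorEval ev.toLinearMap r (K.tensorBracket R p q r x y) =
      K.bracket p q r (K.tensorEval ev.toLinearMap p x) (K.tensorEval ev.toLinearMap q y) := by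
  induction x using TensorProduct.induction_on with
  | zero => simp
  | add x x' hx hx' => simp only [map_add, LinearMap.add_apply, hx, hx']
  | tmul x f =>
    induction y using TensorProduct.induction_on with
    | zero => simp
    | add y y' hy hy' => simp only [map_add, hy, hy']
    | tmul y g =>
      rw [tensorBracket_tmul, tensorEval_tmul, tensorEval_tmul, tensorEval_tmul]
      simp only [AlgHom.toLinearMap_apply]
      rw [map_mul, map_smul, LinearMap.map_smul₂, smul_smul, mul_comm]

/-- The map `K ⊗ R ⟶ K` of DGLs induced by an augmentation of `R`. -/
def baseChangeEval (ev : R →ₐ[ℚ] ℚ) : K.baseChange R ⟶ K where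
  f :=
    { f := fun n => ModuleCat.ofHom (K.tensorEval ev.toLinearMap n)
      comm' := fun i j _ => by
        ext x
        exact (K.tensorEval_d ev.toLinearMap i j x).symm }
  map_bracket p q r x y := K.tensorEval_bracket ev p q r x y

end BaseChange

/-! ### The path object of a DGL with a derivation -/

/-- A derivation of degree zero that commutes with the differential. -/
structure Derivation (K : DGL.{u}) where
  D : ∀ n, K.X.X n →ₗ[ℚ] K.X.X n
  D_d : ∀ i j x, D j ((K.X.d i j).hom x) = (K.X.d i j).hom (D i x)
  D_bracket : ∀ p q r x y, D r (K.bracket p q r x y) =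
    K.bracket p q r (D p x) y + K.bracket p q r x (D q y)

/-- The degrees are freed from their syntactic form, so that one index may be raised by one without
casts. -/
lemma jacobi_of_eq (K : DGL.{u}) {p q r a b c s : ℕ} (ha : p + q = a) (hb : q + r = b)
    (hc : r + p = c) (hs : p + q + r = s) (x : K.X.X p) (y : K.X.X q) (z : K.X.X r) :
    (-1 : ℚ) ^ (p * r) • K.bracket a r s (K.bracket p q a x y) z
      + (-1 : ℚ) ^ (q * p) • K.bracket b p s (K.bracket q r b y z) x
      + (-1 : ℚ) ^ (r * q) • K.bracket c q s (K.bracket r p c z x) y = 0 := by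
  subst ha hb hc hs
  exact K.jacobi p q r x y z

namespace Derivation

variable {K : DGL.{u}} (δ : Derivation K)

/-- Elements `a + b dt` of degree `n` in the path object; in degree zero only cycles are allowed. -/
def pathDeg (n : ℕ) : Submodule ℚ (K.X.X n × K.X.X (n + 1)) where
  carrier := {x | n = 0 → (K.X.d (n + 1) n).hom x.2 + δ.D n x.1 = 0}
  add_mem' {x y} hx hy h := by
    rw [Prod.fst_add, Prod.snd_add, map_add, map_add, add_add_add_comm, hx h, hy h, add_zero]
  zero_mem' h := by simp
  smul_mem' c x hx h := by
    rw [Prod.smul_fst, Prod.smul_snd, map_smul, map_smul, ← smul_add, hx h, smul_zero]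

/-- The differential `a + b dt ↦ ∂ a + (∂ b + (-1)^n a') dt`. -/
def pathD (n : ℕ) : δ.pathDeg (n + 1) →ₗ[ℚ] δ.pathDeg n :=
  LinearMap.restrict
    (LinearMap.prod ((K.X.d (n + 1) n).hom ∘ₗ LinearMap.fst ℚ _ _)
      ((K.X.d (n + 2) (n + 1)).hom ∘ₗ LinearMap.snd ℚ _ _ +
        (-1 : ℚ) ^ (n + 1) • (δ.D (n + 1) ∘ₗ LinearMap.fst ℚ _ _)))
    (by
      rintro ⟨a, b⟩ - rfl
      simp [d_d, δ.D_d])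

lemma pathD_fst (n : ℕ) (x : δ.pathDeg (n + 1)) :
    (δ.pathD n x).1.1 = (K.X.d (n + 1) n).hom x.1.1 := rfl

lemma pathD_snd (n : ℕ) (x : δ.pathDeg (n + 1)) : (δ.pathD n x).1.2 =
    (K.X.d (n + 2) (n + 1)).hom x.1.2 + (-1 : ℚ) ^ (n + 1) • δ.D (n + 1) x.1.1 := rfl

/-- The underlying complex of the path object. -/
def pathComplex : RatComplex.{u} :=
  ChainComplex.of (fun n => ModuleCat.of ℚ (δ.pathDeg n)) (fun n => ModuleCat.ofHom (δ.pathD n))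
    (fun n => by
      refine ModuleCat.hom_ext (LinearMap.ext fun x => Subtype.ext (Prod.ext ?_ ?_))
      · exact d_d K.X _ _ _ _
      change (δ.pathD n (δ.pathD (n + 1) x)).1.2 = 0
      rw [pathD_snd, pathD_snd, pathD_fst, map_add, d_d, map_smul, δ.D_d, zero_add, ← add_smul,
        pow_succ, mul_neg_one, neg_add_cancel, zero_smul])

lemma pathComplex_d (n : ℕ) (x : δ.pathDeg (n + 1)) :
    (δ.pathComplex.d (n + 1) n).hom x = δ.pathD n x := by
  have h : δ.pathComplex.d (n + 1) n = ModuleCat.ofHom (δ.pathD n) := 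
    ChainComplex.of_d (fun n => ModuleCat.of ℚ (δ.pathDeg n)) (fun n => ModuleCat.ofHom (δ.pathD n)) n
  rw [h]
  rfl

end Derivation

end DGL

/-! ### The bracket of the path object -/

namespace DGL.Derivation

variable {K : DGL.{u}} (δ : Derivation K)

/-- The bracket on `K ⊕ K dt`. -/
def pathBracketAux (p q r : ℕ) : K.X.X p × K.X.X (p + 1) →ₗ[ℚ] K.X.X q × K.X.X (q + 1) →ₗ[ℚ]
    K.X.X r × K.X.X (r + 1) :=
  LinearMap.mk₂ ℚ (fun x y => (K.bracket p q r x.1 y.1,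
    K.bracket p (q + 1) (r + 1) x.1 y.2 + (-1 : ℚ) ^ q • K.bracket (p + 1) q (r + 1) x.2 y.1))
    (fun _ _ _ => Prod.ext (by simp) (by simp; abel))
    (fun _ _ _ => Prod.ext (by simp) (by
      simp only [Prod.smul_fst, Prod.smul_snd, map_smul, LinearMap.smul_apply, smul_add]
      rw [smul_comm ((-1 : ℚ) ^ q)]))
    (fun _ _ _ => Prod.ext (by simp) (by simp; abel))
    (fun _ _ _ => Prod.ext (by simp) (by
      simp only [Prod.smul_fst, Prod.smul_snd, map_smul, smul_add]
      rw [smul_comm ((-1 : ℚ) ^ q)]))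

lemma pathBracketAux_apply (p q r : ℕ) (x : K.X.X p × K.X.X (p + 1))
    (y : K.X.X q × K.X.X (q + 1)) : pathBracketAux p q r x y = (K.bracket p q r x.1 y.1,
    K.bracket p (q + 1) (r + 1) x.1 y.2 +
      (-1 : ℚ) ^ q • K.bracket (p + 1) q (r + 1) x.2 y.1) := rfl

lemma pathBracketAux_shape (p q r : ℕ) (h : p + q ≠ r) :
    pathBracketAux (K := K) p q r = 0 := by
  refine LinearMap.ext fun x => LinearMap.ext fun y => ?_
  rw [pathBracketAux_apply, K.bracket_shape p q r h, K.bracket_shape p (q + 1) (r + 1) (by omega),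
    K.bracket_shape (p + 1) q (r + 1) (by omega)]
  refine Prod.ext rfl ?_
  change (0 : K.X.X (r + 1)) + (-1 : ℚ) ^ q • (0 : K.X.X (r + 1)) = 0
  rw [smul_zero, add_zero]

/-- Only `p = q = 0` imposes a condition. There `∂ b = -D a` for both factors, and the Leibniz rules
for `∂` and `D` give the same equation for the bracket. -/
lemma pathBracketAux_mem (p q r : ℕ) (x : δ.pathDeg p) (y : δ.pathDeg q) :
    pathBracketAux p q r x.1 y.1 ∈ δ.pathDeg r := by
  by_cases h : p + q = r
  · rintro rfl
    obtain rfl : p = 0 := by omega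
    obtain rfl : q = 0 := by omega
    have hx := x.2 rfl
    have hy := y.2 rfl
    rw [pathBracketAux_apply, map_add, map_smul]
    have h1 := K.d_bracket 0 (0 + 1) (0 + 1) rfl x.1.1 y.1.2
    have h2 := K.d_bracket (0 + 1) 0 (0 + 1) rfl x.1.2 y.1.1
    have h0 : ∀ z, (K.X.d 0 (0 - 1)).hom z = 0 := fun z => by
      rw [K.X.shape 0 (0 - 1) (by simp)]
      rfl
    rw [h0, map_zero, LinearMap.zero_apply] at h1
    rw [h0, map_zero, smul_zero] at h2
    have h1' : (K.X.d (0 + 1) 0).hom (K.bracket 0 (0 + 1) (0 + 1) x.1.1 y.1.2) =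
      (-1 : ℚ) ^ 0 • K.bracket 0 0 0 x.1.1 ((K.X.d (0 + 1) 0).hom y.1.2) := h1.trans (zero_add _)
    have h2' : (K.X.d (0 + 1) 0).hom (K.bracket (0 + 1) 0 (0 + 1) x.1.2 y.1.1) =
      K.bracket 0 0 0 ((K.X.d (0 + 1) 0).hom x.1.2) y.1.1 := h2.trans (add_zero _)
    change _ + δ.D 0 (K.bracket 0 0 0 x.1.1 y.1.1) = 0
    rw [h1', h2', δ.D_bracket, eq_neg_of_add_eq_zero_left hx, eq_neg_of_add_eq_zero_left hy]
    simp
  · rw [pathBracketAux_shape p q r h]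
    exact Submodule.zero_mem _

/-- The bracket of the path object. -/
def pathBracket (p q r : ℕ) : δ.pathDeg p →ₗ[ℚ] δ.pathDeg q →ₗ[ℚ] δ.pathDeg r :=
  LinearMap.mk₂ ℚ (fun x y => ⟨pathBracketAux p q r x.1 y.1, δ.pathBracketAux_mem p q r x y⟩)
    (fun _ _ _ => Subtype.ext (by simp)) (fun _ _ _ => Subtype.ext (by simp))
    (fun _ _ _ => Subtype.ext (by simp)) (fun _ _ _ => Subtype.ext (by simp))

lemma pathBracket_fst (p q r : ℕ) (x : δ.pathDeg p) (y : δ.pathDeg q) :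
    (δ.pathBracket p q r x y).1.1 = K.bracket p q r x.1.1 y.1.1 := rfl

lemma pathBracket_snd (p q r : ℕ) (x : δ.pathDeg p) (y : δ.pathDeg q) :
    (δ.pathBracket p q r x y).1.2 = K.bracket p (q + 1) (r + 1) x.1.1 y.1.2 +
      (-1 : ℚ) ^ q • K.bracket (p + 1) q (r + 1) x.1.2 y.1.1 := rfl

lemma pathBracket_shape (p q r : ℕ) (h : p + q ≠ r) : δ.pathBracket p q r = 0 := by
  refine LinearMap.ext fun x => LinearMap.ext fun y => Subtype.ext ?_
  exact congrArg (fun f => f x.1 y.1) (pathBracketAux_shape p q r h)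

lemma pathBracket_symm (p q r : ℕ) (x : δ.pathDeg p) (y : δ.pathDeg q) :
    δ.pathBracket p q r x y = (-1 : ℚ) ^ (p * q + 1) • δ.pathBracket q p r y x := by
  refine Subtype.ext (Prod.ext (K.bracket_symm p q r _ _) ?_)
  change (δ.pathBracket p q r x y).1.2 =
    (-1 : ℚ) ^ (p * q + 1) • (δ.pathBracket q p r y x).1.2
  rw [pathBracket_snd, pathBracket_snd, K.bracket_symm p (q + 1), K.bracket_symm (p + 1) q,
    smul_add, smul_smul, smul_smul]
  refine (add_comm _ _).trans (congrArg₂ (· + ·) (congrArg (· • _) ?_) (congrArg (· • _) ?_))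
  · rw [← pow_add, show q + ((p + 1) * q + 1) = (p * q + 1) + 2 * q by ring, pow_add, pow_mul]
    simp
  · rw [← pow_add]
    ring

lemma pathBracket_jacobi (p q r : ℕ) (x : δ.pathDeg p) (y : δ.pathDeg q) (z : δ.pathDeg r) :
    (-1 : ℚ) ^ (p * r) • δ.pathBracket (p + q) r (p + q + r) (δ.pathBracket p q (p + q) x y) z
      + (-1 : ℚ) ^ (q * p) • δ.pathBracket (q + r) p (p + q + r) (δ.pathBracket q r (q + r) y z) x
      + (-1 : ℚ) ^ (r * q) • δ.pathBracket (r + p) q (p + q + r) (δ.pathBracket r p (r + p) z x) y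
      = 0 := by
  refine Subtype.ext (Prod.ext (K.jacobi p q r _ _ _) ?_)
  change (-1 : ℚ) ^ (p * r) •
      (δ.pathBracket (p + q) r (p + q + r) (δ.pathBracket p q (p + q) x y) z).1.2
      + (-1 : ℚ) ^ (q * p) •
      (δ.pathBracket (q + r) p (p + q + r) (δ.pathBracket q r (q + r) y z) x).1.2
      + (-1 : ℚ) ^ (r * q) •
      (δ.pathBracket (r + p) q (p + q + r) (δ.pathBracket r p (r + p) z x) y).1.2 = 0
  simp only [pathBracket_snd, pathBracket_fst, map_add, LinearMap.add_apply, map_smul,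
    LinearMap.smul_apply]
  -- The `dt`-component is the sum of three Jacobi identities of `K`, with `dt` carried by `z`, `y`
  -- and `x` in turn, weighted by `(-1)^p`, `(-1)^r` and `(-1)^q`.
  have h1 := K.jacobi_of_eq (p := p) (q := q) (r := r + 1) (a := p + q) (b := q + r + 1)
    (c := r + p + 1) (s := p + q + r + 1) rfl rfl (by omega) rfl x.1.1 y.1.1 z.1.2
  have h2 := K.jacobi_of_eq (p := p) (q := q + 1) (r := r) (a := p + q + 1) (b := q + r + 1)
    (c := r + p) (s := p + q + r + 1) rfl (by omega) rfl (by omega) x.1.1 y.1.2 z.1.1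
  have h3 := K.jacobi_of_eq (p := p + 1) (q := q) (r := r) (a := p + q + 1) (b := q + r)
    (c := r + p + 1) (s := p + q + r + 1) (by omega) rfl rfl (by omega) x.1.2 y.1.1 z.1.1
  rw [show p * (r + 1) = p * r + p by ring, show (r + 1) * q = r * q + q by ring,
    pow_add, pow_add] at h1
  rw [show (q + 1) * p = q * p + p by ring, show r * (q + 1) = r * q + r by ring,
    pow_add, pow_add] at h2
  rw [show (p + 1) * r = p * r + r by ring, show q * (p + 1) = q * p + q by ring,
    pow_add, pow_add] at h3
  generalize (-1 : ℚ) ^ (p * r) = a at *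
  generalize (-1 : ℚ) ^ (q * p) = b at *
  generalize (-1 : ℚ) ^ (r * q) = c at *
  have hp := neg_one_pow_eq_or ℚ p
  have hq := neg_one_pow_eq_or ℚ q
  have hr := neg_one_pow_eq_or ℚ r
  generalize (-1 : ℚ) ^ p = sp at *
  generalize (-1 : ℚ) ^ q = sq at *
  generalize (-1 : ℚ) ^ r = sr at *
  rcases hp with rfl | rfl <;> rcases hq with rfl | rfl <;> rcases hr with rfl | rfl
  · linear_combination (norm := module) h1 + h2 + h3
  · linear_combination (norm := module) h1 - h2 + h3
  · linear_combination (norm := module) h1 + h2 - h3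
  · linear_combination (norm := module) h1 - h2 - h3
  · linear_combination (norm := module) -h1 + h2 + h3
  · linear_combination (norm := module) -h1 - h2 + h3
  · linear_combination (norm := module) -h1 + h2 - h3
  · linear_combination (norm := module) -h1 - h2 - h3

end DGL.Derivation

namespace DGL

lemma d_apply_zero (L : RatComplex.{u}) (x : L.X 0) : (L.d 0 (0 - 1)).hom x = 0 := by
  rw [L.shape 0 (0 - 1) (by simp)]
  rfl

lemma d_bracket_zero_left (K : DGL.{u}) (q : ℕ) (x : K.X.X 0) (y : K.X.X (q + 1)) :
    (K.X.d (q + 1) q).hom (K.bracket 0 (q + 1) (q + 1) x y) =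
      K.bracket 0 q q x ((K.X.d (q + 1) q).hom y) := by
  have h := K.d_bracket 0 (q + 1) (q + 1) (by omega) x y
  rw [d_apply_zero, LinearMap.map_zero₂, pow_zero, one_smul, zero_add] at h
  exact h

lemma d_bracket_zero_right (K : DGL.{u}) (p : ℕ) (x : K.X.X (p + 1)) (y : K.X.X 0) :
    (K.X.d (p + 1) p).hom (K.bracket (p + 1) 0 (p + 1) x y) =
      K.bracket p 0 p ((K.X.d (p + 1) p).hom x) y := by
  have h := K.d_bracket (p + 1) 0 (p + 1) (by omega) x y
  rw [d_apply_zero, map_zero, smul_zero, add_zero] at h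
  exact h

namespace Derivation

variable {K : DGL.{u}} (δ : Derivation K)

/-- The Leibniz rule is split according to whether a degree is zero. In degree zero there is no
outgoing differential, and the cycle condition built into `pathDeg 0` cancels the surplus terms. -/
lemma pathD_pathBracket_succ_succ (p q r : ℕ) (hr : p + 1 + q = r) (x : δ.pathDeg (p + 1))
    (y : δ.pathDeg (q + 1)) : δ.pathD r (δ.pathBracket (p + 1) (q + 1) (r + 1) x y) =
      δ.pathBracket p (q + 1) r (δ.pathD p x) y +
        (-1 : ℚ) ^ (p + 1) • δ.pathBracket (p + 1) q r x (δ.pathD q y) := by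
  refine Subtype.ext (Prod.ext (K.d_bracket (p + 1) (q + 1) (r + 1) (by omega) _ _) ?_)
  change (δ.pathD r (δ.pathBracket (p + 1) (q + 1) (r + 1) x y)).1.2 =
      (δ.pathBracket p (q + 1) r (δ.pathD p x) y).1.2 +
        (-1 : ℚ) ^ (p + 1) • (δ.pathBracket (p + 1) q r x (δ.pathD q y)).1.2
  simp only [pathD_snd, pathD_fst, pathBracket_snd, pathBracket_fst]
  have h1 := K.d_bracket (p + 1) (q + 2) (r + 2) (by omega) x.1.1 y.1.2
  have h2 := K.d_bracket (p + 2) (q + 1) (r + 2) (by omega) x.1.2 y.1.1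
  change (K.X.d (r + 2) (r + 1)).hom _ = K.bracket p (q + 2) (r + 1)
    ((K.X.d (p + 1) p).hom x.1.1) y.1.2 + (-1 : ℚ) ^ (p + 1) •
    K.bracket (p + 1) (q + 1) (r + 1) x.1.1 ((K.X.d (q + 2) (q + 1)).hom y.1.2) at h1
  change (K.X.d (r + 2) (r + 1)).hom _ = K.bracket (p + 1) (q + 1) (r + 1)
    ((K.X.d (p + 2) (p + 1)).hom x.1.2) y.1.1 + (-1 : ℚ) ^ (p + 2) •
    K.bracket (p + 2) q (r + 1) x.1.2 ((K.X.d (q + 1) q).hom y.1.1) at h2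
  rw [map_add, map_smul, h1, h2, δ.D_bracket, ← hr]
  simp only [map_add, LinearMap.add_apply, map_smul, LinearMap.smul_apply, pow_add, pow_one]
  have hp := neg_one_pow_eq_or ℚ p
  have hq := neg_one_pow_eq_or ℚ q
  generalize (-1 : ℚ) ^ p = sp at *
  generalize (-1 : ℚ) ^ q = sq at *
  rcases hp with rfl | rfl <;> rcases hq with rfl | rfl <;> module

lemma pathD_pathBracket_zero_succ (q r : ℕ) (hr : q = r) (x : δ.pathDeg 0)
    (y : δ.pathDeg (q + 1)) : δ.pathD r (δ.pathBracket 0 (q + 1) (r + 1) x y) =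
      δ.pathBracket 0 q r x (δ.pathD q y) := by
  subst hr
  have h1 := K.d_bracket_zero_left (q + 1) x.1.1 y.1.2
  have h2 := K.d_bracket 1 (q + 1) (q + 2) (by omega) x.1.2 y.1.1
  refine Subtype.ext (Prod.ext (K.d_bracket_zero_left q x.1.1 y.1.1) ?_)
  simp only [pathD_snd, pathD_fst, pathBracket_snd, pathBracket_fst]
  change (K.X.d (q + 2) (q + 1)).hom _ = K.bracket 0 (q + 1) (q + 1)
    ((K.X.d 1 0).hom x.1.2) y.1.1 + (-1 : ℚ) ^ 1 •
    K.bracket 1 q (q + 1) x.1.2 ((K.X.d (q + 1) q).hom y.1.1) at h2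
  rw [map_add, map_smul, h1, h2, δ.D_bracket, eq_neg_of_add_eq_zero_left (x.2 rfl)]
  simp only [map_add, map_neg, LinearMap.neg_apply, map_smul, pow_add, pow_one]
  module

lemma pathD_pathBracket_succ_zero (p r : ℕ) (hr : p = r) (x : δ.pathDeg (p + 1))
    (y : δ.pathDeg 0) : δ.pathD r (δ.pathBracket (p + 1) 0 (r + 1) x y) =
      δ.pathBracket p 0 r (δ.pathD p x) y := by
  subst hr
  have h1 := K.d_bracket (p + 1) 1 (p + 2) (by omega) x.1.1 y.1.2
  have h2 := K.d_bracket_zero_right (p + 1) x.1.2 y.1.1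
  refine Subtype.ext (Prod.ext (K.d_bracket_zero_right p x.1.1 y.1.1) ?_)
  simp only [pathD_snd, pathD_fst, pathBracket_snd, pathBracket_fst]
  change (K.X.d (p + 2) (p + 1)).hom _ = K.bracket p 1 (p + 1)
    ((K.X.d (p + 1) p).hom x.1.1) y.1.2 + (-1 : ℚ) ^ (p + 1) •
    K.bracket (p + 1) 0 (p + 1) x.1.1 ((K.X.d 1 0).hom y.1.2) at h1
  rw [map_add, map_smul, h1, h2, δ.D_bracket, eq_neg_of_add_eq_zero_left (y.2 rfl)]
  simp only [map_add, map_neg, LinearMap.add_apply, map_smul, LinearMap.smul_apply, pow_add,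
    pow_one, pow_zero]
  module

/-- The path object of a DGL with a derivation: elements `a + b dt`, where `dt` has degree `-1`
and `∂ a = ∂ a + (-1)^n a' dt`. -/
def pathDGL : DGL.{u} where
  X := δ.pathComplex
  bracket p q r := δ.pathBracket p q r
  bracket_shape p q r h := δ.pathBracket_shape p q r h
  bracket_symm p q r x y := δ.pathBracket_symm p q r x y
  jacobi p q r x y z := δ.pathBracket_jacobi p q r x y z
  d_bracket p q r hr x y := by
    rcases p with _ | p <;> rcases q with _ | q
    · obtain rfl : r = 0 := by omega
      refine (d_apply_zero _ _).trans (Eq.symm ?_)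
      refine (congrArg₂ (fun z w => δ.pathBracket 0 0 0 z y + (-1 : ℚ) ^ 0 •
        δ.pathBracket 0 0 0 x w) (d_apply_zero _ x) (d_apply_zero _ y)).trans ?_
      change δ.pathBracket 0 0 0 0 y + (-1 : ℚ) ^ 0 • δ.pathBracket 0 0 0 x 0 = 0
      simp
      rfl
    · obtain ⟨r, rfl⟩ : ∃ r', r = r' + 1 := ⟨r - 1, by omega⟩
      refine (δ.pathComplex_d r _).trans ?_
      refine (δ.pathD_pathBracket_zero_succ q r (by omega) x y).trans (Eq.symm ?_)
      refine (congrArg₂ (fun z w => δ.pathBracket 0 (q + 1) r z y + (-1 : ℚ) ^ 0 •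
        δ.pathBracket 0 q r x w) (d_apply_zero _ x) (δ.pathComplex_d q y)).trans ?_
      change δ.pathBracket 0 (q + 1) r 0 y + (-1 : ℚ) ^ 0 • δ.pathBracket 0 q r x _ = _
      simp
      rfl
    · obtain ⟨r, rfl⟩ : ∃ r', r = r' + 1 := ⟨r - 1, by omega⟩
      refine (δ.pathComplex_d r _).trans ?_
      refine (δ.pathD_pathBracket_succ_zero p r (by omega) x y).trans (Eq.symm ?_)
      refine (congrArg₂ (fun z w => δ.pathBracket p 0 r z y + (-1 : ℚ) ^ (p + 1) •
        δ.pathBracket (p + 1) 0 r x w) (δ.pathComplex_d p x) (d_apply_zero _ y)).trans ?_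
      change δ.pathBracket p 0 r _ y + (-1 : ℚ) ^ (p + 1) • δ.pathBracket (p + 1) 0 r x 0 = _
      simp
    · obtain ⟨r, rfl⟩ : ∃ r', r = r' + 1 := ⟨r - 1, by omega⟩
      refine (δ.pathComplex_d r _).trans ?_
      refine (δ.pathD_pathBracket_succ_succ p q r (by omega) x y).trans ?_
      exact congrArg₂ (fun z w => δ.pathBracket p (q + 1) r z y +
        (-1 : ℚ) ^ (p + 1) • δ.pathBracket (p + 1) q r x w)
        (δ.pathComplex_d p x).symm (δ.pathComplex_d q y).symm

/-- The projection from the path object. -/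
def pathProj : δ.pathDGL ⟶ K where
  f :=
    { f := fun n => ModuleCat.ofHom (LinearMap.fst ℚ _ _ ∘ₗ (δ.pathDeg n).subtype)
      comm' := fun i j h => by
        obtain rfl : j + 1 = i := h
        ext x
        exact (congrArg (fun z : δ.pathDeg j => z.1.1) (δ.pathComplex_d j x)).symm }
  map_bracket _ _ _ _ _ := rfl

/-- In degree zero the equation is membership in `pathDeg`; in positive degree it is the
`dt`-component of the cycle equation. -/
lemma cycle_snd (n : ℕ) (x : δ.pathDeg n) (hx : x ∈ δ.pathDGL.cyc n) :
    (K.X.d (n + 1) n).hom x.1.2 + (-1 : ℚ) ^ n • δ.D n x.1.1 = 0 := by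
  rcases n with _ | n
  · simpa using x.2 rfl
  · have h : δ.pathD n x = 0 := (δ.pathComplex_d n x).symm.trans hx
    exact congrArg (fun z : δ.pathDeg n => z.1.2) h

end Derivation


/-! ### Polynomial paths and integration -/

open TensorProduct

/-- Differentiation of polynomials with coefficients in a vector space. -/
abbrev polyD (K : DGL.{u}) (n : ℕ) :
    K.X.X n ⊗[ℚ] Polynomial ℚ →ₗ[ℚ] K.X.X n ⊗[ℚ] Polynomial ℚ :=
  LinearMap.lTensor (K.X.X n) Polynomial.derivative

lemma polyD_d (K : DGL.{u}) (i j : ℕ) (x : K.X.X i ⊗[ℚ] Polynomial ℚ) :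
    K.polyD j (LinearMap.rTensor (Polynomial ℚ) (K.X.d i j).hom x) =
      LinearMap.rTensor (Polynomial ℚ) (K.X.d i j).hom (K.polyD i x) := by
  rw [← LinearMap.comp_apply, ← LinearMap.comp_apply, LinearMap.lTensor_comp_rTensor,
    LinearMap.rTensor_comp_lTensor]

lemma polyD_bracket (K : DGL.{u}) (p q r : ℕ) (x : K.X.X p ⊗[ℚ] Polynomial ℚ)
    (y : K.X.X q ⊗[ℚ] Polynomial ℚ) :
    K.polyD r (K.tensorBracket (Polynomial ℚ) p q r x y) =
      K.tensorBracket (Polynomial ℚ) p q r (K.polyD p x) y +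
      K.tensorBracket (Polynomial ℚ) p q r x (K.polyD q y) := by
  induction x using TensorProduct.induction_on with
  | zero => simp
  | add x x' hx hx' =>
    simp only [map_add, LinearMap.add_apply, hx, hx']
    abel
  | tmul x f =>
    induction y using TensorProduct.induction_on with
    | zero => simp
    | add y y' hy hy' =>
      simp only [map_add, hy, hy']
      abel
    | tmul y g =>
      simp only [tensorBracket_tmul, LinearMap.lTensor_tmul, Polynomial.derivative_mul,
        TensorProduct.tmul_add]

/-- Differentiation of polynomials with coefficients in a DGL. -/
def polyDerivation (K : DGL.{u}) : Derivation (K.baseChange (Polynomial ℚ)) where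
  D n := K.polyD n
  D_d i j x := K.polyD_d i j x
  D_bracket p q r x y := K.polyD_bracket p q r x y

/-- Integration of polynomials over the unit interval. -/
def polyIntegral : Polynomial ℚ →ₗ[ℚ] ℚ :=
  Polynomial.lsum fun n => ((n : ℚ) + 1)⁻¹ • LinearMap.id

lemma polyIntegral_derivative (f : Polynomial ℚ) : polyIntegral (Polynomial.derivative f) =
    Polynomial.aeval (1 : ℚ) f - Polynomial.aeval (0 : ℚ) f := by
  induction f using Polynomial.induction_on' with
  | add f g hf hg => rw [map_add, map_add, hf, hg, map_add, map_add]; ring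
  | monomial n a =>
    rw [Polynomial.derivative_monomial, polyIntegral]
    rcases n with _ | n
    · simp
    · have h : (n : ℚ) + 1 ≠ 0 := by positivity
      simp [Polynomial.sum_monomial_index, Polynomial.aeval_monomial]
      field_simp

lemma tensorEval_polyIntegral (K : DGL.{u}) (n : ℕ) (x : K.X.X n ⊗[ℚ] Polynomial ℚ) :
    K.tensorEval polyIntegral n (K.polyD n x) =
      K.tensorEval (Polynomial.aeval (1 : ℚ)).toLinearMap n x -
        K.tensorEval (Polynomial.aeval (0 : ℚ)).toLinearMap n x := by
  induction x using TensorProduct.induction_on with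
  | zero => simp
  | add x x' hx hx' =>
    rw [map_add, map_add, map_add, map_add]
    rw [hx, hx']
    abel
  | tmul x f =>
    change polyIntegral (Polynomial.derivative f) • x = Polynomial.aeval (1 : ℚ) f • x -
      Polynomial.aeval (0 : ℚ) f • x
    rw [polyIntegral_derivative, sub_smul]

/-- Integrate the equation from 0 to 1: the endpoints differ by `∫ x'`, and integration commutes
with `∂`, so this is `∂` of `∫ y` up to sign. -/
lemma tensorEval_sub_mem_bdry (K : DGL.{u}) (n : ℕ) (x : K.X.X n ⊗[ℚ] Polynomial ℚ)
    (y : K.X.X (n + 1) ⊗[ℚ] Polynomial ℚ)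
    (h : LinearMap.rTensor (Polynomial ℚ) (K.X.d (n + 1) n).hom y +
      (-1 : ℚ) ^ n • K.polyD n x = 0) :
    K.tensorEval (Polynomial.aeval (1 : ℚ)).toLinearMap n x -
      K.tensorEval (Polynomial.aeval (0 : ℚ)).toLinearMap n x ∈ K.bdry n := by
  replace h := (congrArg (K.tensorEval polyIntegral n) h).trans (map_zero _)
  rw [map_add, map_smul, tensorEval_d, add_comm] at h
  rw [← K.tensorEval_polyIntegral n x]
  refine ⟨-(-1 : ℚ) ^ n • K.tensorEval polyIntegral (n + 1) y, ?_⟩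
  rw [map_smul, eq_neg_of_add_eq_zero_right h, smul_neg, neg_smul, neg_neg, smul_smul, ← mul_pow]
  simp

/-- The path object `K[t, dt]`. -/
abbrev polyPath (K : DGL.{u}) : DGL.{u} := K.polyDerivation.pathDGL

/-- Evaluation of paths at a rational number. -/
def polyPathEval (K : DGL.{u}) (c : ℚ) : K.polyPath ⟶ K :=
  K.polyDerivation.pathProj ≫ K.baseChangeEval (Polynomial.aeval c)

lemma polyPathEval_apply (K : DGL.{u}) (c : ℚ) (n : ℕ) (x : K.polyDerivation.pathDeg n) :
    ((Hom.f (K.polyPathEval c)).f n).hom x =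
      K.tensorEval (Polynomial.aeval c).toLinearMap n x.1.1 := rfl

/-- The endpoints of a cycle in the path object are homologous. -/
lemma polyPathEval_sub_mem (K : DGL.{u}) (n : ℕ) (x : K.polyDerivation.pathDeg n)
    (hx : x ∈ K.polyPath.cyc n) : ((Hom.f (K.polyPathEval 1)).f n).hom x -
      ((Hom.f (K.polyPathEval 0)).f n).hom x ∈ K.bdry n :=
  K.tensorEval_sub_mem_bdry n x.1.1 x.1.2 (K.polyDerivation.cycle_snd n x hx)

/-! ### The path from the projection `e` to the identity -/

section Lift

variable {V : RatComplex.{u}} (S : RatComplex.Splitting V) (Y : DGL.{u}) (ι : V ⟶ Y.X)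

/-- The polynomial part of the canonical path from the projection `e` to the identity. -/
def pathLiftFst (n : ℕ) : V.X n →ₗ[ℚ] Y.X.X n ⊗[ℚ] Polynomial ℚ :=
  (TensorProduct.mk ℚ (Y.X.X n) (Polynomial ℚ)).flip 1 ∘ₗ (ι.f n).hom ∘ₗ S.e n +
    (TensorProduct.mk ℚ (Y.X.X n) (Polynomial ℚ)).flip Polynomial.X ∘ₗ (ι.f n).hom ∘ₗ S.θ n

lemma pathLiftFst_apply (n : ℕ) (v : V.X n) : pathLiftFst S Y ι n v =
    (ι.f n).hom (S.e n v) ⊗ₜ 1 + (ι.f n).hom (S.θ n v) ⊗ₜ Polynomial.X := rfl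

/-- The form part of the canonical path from the projection `e` to the identity. -/
def pathLiftSnd (n : ℕ) : V.X n →ₗ[ℚ] Y.X.X (n + 1) ⊗[ℚ] Polynomial ℚ :=
  (-1 : ℚ) ^ (n + 1) • ((TensorProduct.mk ℚ (Y.X.X (n + 1)) (Polynomial ℚ)).flip 1 ∘ₗ
    (ι.f (n + 1)).hom ∘ₗ S.h n (n + 1))

lemma pathLiftSnd_apply (n : ℕ) (v : V.X n) : pathLiftSnd S Y ι n v =
    (-1 : ℚ) ^ (n + 1) • ((ι.f (n + 1)).hom (S.h n (n + 1) v) ⊗ₜ 1) := rfl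

/-- The path is `e v + t θ v + (-1)^(n+1) h v dt`. As `θ = ∂ h + h ∂`, the `∂ h` terms cancel. What
is left is the `dt`-part of the path of `∂ v`, and it vanishes in degree zero. -/
lemma pathLift_snd_eq (n : ℕ) (v : V.X n) :
    LinearMap.rTensor (Polynomial ℚ) (Y.X.d (n + 1) n).hom (pathLiftSnd S Y ι n v) +
      (-1 : ℚ) ^ n • LinearMap.lTensor _ Polynomial.derivative (pathLiftFst S Y ι n v) =
    (-1 : ℚ) ^ n • ((ι.f n).hom (S.h (n - 1) n ((V.d n (n - 1)).hom v)) ⊗ₜ 1) := by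
  rw [pathLiftSnd_apply, pathLiftFst_apply, map_smul, LinearMap.rTensor_tmul, map_add,
    LinearMap.lTensor_tmul, LinearMap.lTensor_tmul, Polynomial.derivative_one,
    Polynomial.derivative_X, TensorProduct.tmul_zero, zero_add, ← map_d, S.θ_apply, map_add,
    TensorProduct.add_tmul, pow_succ]
  module

lemma pathLift_fst_eq (i j : ℕ) (v : V.X i) :
    LinearMap.rTensor (Polynomial ℚ) (Y.X.d i j).hom (pathLiftFst S Y ι i v) =
      pathLiftFst S Y ι j ((V.d i j).hom v) := by
  have h : (V.d i j).hom (S.θ i v) = (V.d i j).hom v := by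
    have := S.d_e i j v
    rwa [S.e_apply, map_sub, sub_eq_zero, eq_comm] at this
  have h' : S.θ j ((V.d i j).hom v) = (V.d i j).hom v := by
    have := S.e_d j i v
    rwa [S.e_apply, sub_eq_zero, eq_comm] at this
  rw [pathLiftFst_apply, pathLiftFst_apply, map_add, LinearMap.rTensor_tmul,
    LinearMap.rTensor_tmul, ← map_d, ← map_d, S.d_e, S.e_d, h, h', map_zero]

/-- The canonical path from the projection `e` to the identity. -/
def pathLift (n : ℕ) : V.X n →ₗ[ℚ] Y.polyDerivation.pathDeg n :=
  LinearMap.codRestrict _ (LinearMap.prod (pathLiftFst S Y ι n) (pathLiftSnd S Y ι n)) (by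
    rintro v rfl
    have h := pathLift_snd_eq S Y ι 0 v
    rw [d_apply_zero, map_zero, map_zero, TensorProduct.zero_tmul, smul_zero, pow_zero,
      one_smul] at h
    exact h)

/-- The canonical path from the projection `e` to the identity, as a chain map. -/
def pathLiftHom : V ⟶ Y.polyPath.X where
  f n := ModuleCat.ofHom (pathLift S Y ι n)
  comm' i j h := by
    obtain rfl : j + 1 = i := h
    refine ModuleCat.hom_ext (LinearMap.ext fun v => ?_)
    refine (Y.polyDerivation.pathComplex_d j (pathLift S Y ι (j + 1) v)).trans ?_
    refine Subtype.ext (Prod.ext (pathLift_fst_eq S Y ι (j + 1) j v) ?_)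
    refine (pathLift_snd_eq S Y ι (j + 1) v).trans ?_
    exact (pathLiftSnd_apply S Y ι j _).symm

end Lift

/-- The endomorphism of a free DGL induced by the projection `e` of the generators induces the
identity on homology. -/
theorem IsFreeOn.sub_mem_bdry {V : RatComplex.{u}} {Y : DGL.{u}} {ι : V ⟶ Y.X}
    (hι : IsFreeOn (L := Y) ι) (S : RatComplex.Splitting V) (E : Y ⟶ Y)
    (hE : ∀ n v, ((Hom.f E).f n).hom ((ι.f n).hom v) = (ι.f n).hom (S.e n v)) (n : ℕ)
    (y : Y.X.X n) (hy : y ∈ Y.cyc n) : y - ((Hom.f E).f n).hom y ∈ Y.bdry n := by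
  obtain ⟨F, hF, -⟩ := hι Y.polyPath (pathLiftHom S Y ι)
  have hF' : ∀ n v, ((Hom.f F).f n).hom ((ι.f n).hom v) = pathLift S Y ι n v := fun n v =>
    congrArg (fun g : V ⟶ Y.polyPath.X => (g.f n).hom v) hF
  have huniq : ∀ G G' : Y ⟶ Y, (∀ n v, ((Hom.f G).f n).hom ((ι.f n).hom v) =
      ((Hom.f G').f n).hom ((ι.f n).hom v)) → G = G' := fun G G' h => by
    refine (hι Y (ι ≫ toComplex.map G')).unique ?_ rfl
    ext n v
    exact h n v
  -- On generators the path starts at `e` and ends at `e + θ = 1`; freeness extends both equalities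
  -- to all of `Y`.
  have h0 : F ≫ Y.polyPathEval 0 = E := huniq _ _ fun n v => by
    rw [hE, comp_apply, hF', polyPathEval_apply]
    change Y.tensorEval _ n (pathLiftFst S Y ι n v) = _
    rw [pathLiftFst_apply, map_add, tensorEval_tmul, tensorEval_tmul]
    simp
  have h1 : F ≫ Y.polyPathEval 1 = 𝟙 Y := huniq _ _ fun n v => by
    rw [comp_apply, hF', polyPathEval_apply]
    change Y.tensorEval _ n (pathLiftFst S Y ι n v) = (ι.f n).hom v
    rw [pathLiftFst_apply, map_add, tensorEval_tmul, tensorEval_tmul]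
    simp [S.e_apply]
  have h := Y.polyPathEval_sub_mem n (((Hom.f F).f n).hom y) (cycMap (Hom.f F) n ⟨y, hy⟩).2
  rw [← comp_apply, ← comp_apply, h0, h1] at h
  exact h


/-! ### Homology and abelianization of free DGLs -/

lemma IsFreeOn.hom_ext {V : RatComplex.{u}} {Y : DGL.{u}} {ι : V ⟶ Y.X}
    (hι : IsFreeOn (L := Y) ι) {G : DGL.{u}} {φ ψ : Y ⟶ G}
    (h : ∀ n v, ((Hom.f φ).f n).hom ((ι.f n).hom v) = ((Hom.f ψ).f n).hom ((ι.f n).hom v)) :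
    φ = ψ := by
  refine (hι G (ι ≫ toComplex.map ψ)).unique ?_ rfl
  ext n v
  exact h n v

/-- The homology of a free DGL is generated by the homology of the generating complex. -/
theorem IsFreeOn.homologyDGL_hom_ext {V : RatComplex.{u}} {Y : DGL.{u}} {ι : V ⟶ Y.X}
    (hι : IsFreeOn (L := Y) ι) {G : DGL.{u}} {φ ψ : Y.homologyDGL ⟶ G}
    (h : ∀ n (c : (triv V).Hmod n), ((Hom.f φ).f n).hom (Hmap (K := triv V) (L := Y) ι n c) =
      ((Hom.f ψ).f n).hom (Hmap (K := triv V) (L := Y) ι n c)) : φ = ψ := by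
  obtain ⟨S⟩ := (inferInstance : Nonempty (RatComplex.Splitting V))
  let g : V ⟶ Y.cyclesDGL.X :=
    { f := fun n => ModuleCat.ofHom (cycMap (K := triv V) (L := Y) ι n ∘ₗ S.eCyc n)
      comm' := fun i j _ => by
        refine Limits.comp_zero.trans ?_
        refine ModuleCat.hom_ext (LinearMap.ext fun x => ?_)
        have h1 : S.eCyc j ((V.d i j).hom x) = 0 := Subtype.ext (S.e_d _ _ x)
        exact ((congrArg (cycMap (K := triv V) (L := Y) ι j) h1).trans (map_zero _)).symm }
  -- The endomorphism induced by `e` lands in the cycles, so `E` followed by the projection is a DGL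
  -- map from `Y` itself to its homology. Freeness applies to that map, and every homology class has
  -- a representative in the image of `E`.
  obtain ⟨E, hE, -⟩ := hι Y.cyclesDGL g
  have hE' : ∀ n v, ((Hom.f E).f n).hom ((ι.f n).hom v) =
      cycMap (K := triv V) (L := Y) ι n (S.eCyc n v) := fun n v =>
    congrArg (fun g : V ⟶ Y.cyclesDGL.X => (g.f n).hom v) hE
  have key : E ≫ Y.cyclesProj ≫ φ = E ≫ Y.cyclesProj ≫ ψ := hι.hom_ext fun n v => by
    rw [comp_apply, comp_apply, comp_apply, comp_apply, hE']
    exact h n ((triv V).cls n (S.eCyc n v))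
  refine DGL.hom_ext fun n x => ?_
  obtain ⟨x, rfl⟩ := Y.cls_surjective n x
  have hx := hι.sub_mem_bdry S (E ≫ Y.cyclesIncl) (fun n v => by rw [comp_apply, hE']; rfl)
    n x.1 x.2
  have hx' : Y.cls n x = Y.cls n (((Hom.f E).f n).hom x.1) := (Y.cls_eq_iff n _ _).2 hx
  rw [hx']
  exact congrArg (fun F : Y ⟶ G => ((Hom.f F).f n).hom x.1) key

/-- The cycles of the abelianization of a free DGL come from the cycles of the generating
complex. -/
lemma IsFreeOn.exists_cyc {V : RatComplex.{u}} {Y : DGL.{u}} {ι : V ⟶ Y.X}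
    (hι : IsFreeOn (L := Y) ι) (n : ℕ) (c : (triv (ab.obj Y)).cyc n) :
    ∃ v : (triv V).cyc n, ((Hom.f Y.abProj).f n).hom ((ι.f n).hom v) = c := by
  obtain ⟨r, hr, -⟩ := hι (triv V) (𝟙 V)
  have hr' : ∀ n v, ((Hom.f r).f n).hom ((ι.f n).hom v) = v := fun n v =>
    congrArg (fun g : V ⟶ V => (g.f n).hom v) hr
  let s : triv V ⟶ triv (ab.obj Y) := { f := ι ≫ Hom.f Y.abProj, map_bracket := by simp }
  -- Thus `Y → Ab(Y)` factors through the retraction `r` onto `V`. Since `r` kills brackets, it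
  -- sends any lift of a cycle of `Ab(Y)` to a cycle of `V`.
  have key : r ≫ s = Y.abProj := hι.hom_ext fun n v => by
    rw [comp_apply, hr']
    rfl
  obtain ⟨y, hy⟩ := (Y.decomposables n).mkQ_surjective c.1
  have hc : ((ab.obj Y).d n (n - 1)).hom c.1 = 0 := c.2
  have hdy : (Y.X.d n (n - 1)).hom y ∈ Y.decomposables (n - 1) := by
    rw [← hy] at hc
    exact (Submodule.Quotient.mk_eq_zero _).1 hc
  have hrd : ∀ m, Y.decomposables m ≤ LinearMap.ker ((Hom.f r).f m).hom := fun m => by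
    refine Submodule.span_le.2 ?_
    rintro z ⟨p, q, x, y, rfl⟩
    exact Hom.map_bracket r p q m x y
  refine ⟨⟨((Hom.f r).f n).hom y, ?_⟩, ?_⟩
  · exact (map_d (Hom.f r) n (n - 1) y).symm.trans (hrd _ hdy)
  · rw [← hy]
    exact congrArg (fun F : Y ⟶ triv (ab.obj Y) => ((Hom.f F).f n).hom y) key

/-- Maps out of a free DGL that agree on homology have abelianizations that agree on homology. -/
theorem IsFreeOn.ab_sub_mem_bdry {V : RatComplex.{u}} {Y : DGL.{u}} {ι : V ⟶ Y.X}
    (hι : IsFreeOn (L := Y) ι) {K : DGL.{u}} {F G : Y ⟶ K}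
    (h : homologyDGLFunctor.map F = homologyDGLFunctor.map G) (n : ℕ)
    (c : (triv (ab.obj Y)).cyc n) :
    ((ab.map F).f n).hom c.1 - ((ab.map G).f n).hom c.1 ∈ (triv (ab.obj K)).bdry n := by
  obtain ⟨v, hv⟩ := hι.exists_cyc n c
  have h1 := congrArg (fun f => f (Hmap (K := triv V) (L := Y) ι n ((triv V).cls n v)))
    ((homologyDGLFunctor_map_eq_iff F G).1 h n)
  obtain ⟨z, hz⟩ := (K.cls_eq_iff n _ _).1 h1
  rw [← hv]
  refine ⟨((Hom.f K.abProj).f (n + 1)).hom z, ?_⟩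
  refine (map_d (Hom.f K.abProj) (n + 1) n z).symm.trans ?_
  exact (congrArg ((Hom.f K.abProj).f n).hom hz).trans (map_sub _ _ _)

end DGL

/-! ### Invariance of homology and of homotopy classes -/

lemma homologyMap_eq_of_sub_mem_bdry {V W : RatComplex.{u}} {φ ψ : V ⟶ W} (n : ℕ)
    (h : ∀ c : (DGL.triv V).cyc n, (φ.f n).hom c.1 - (ψ.f n).hom c.1 ∈ (DGL.triv W).bdry n) :
    HomologicalComplex.homologyMap φ n = HomologicalComplex.homologyMap ψ n := by
  refine ModuleCat.hom_ext (LinearMap.ext fun x => ?_)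
  obtain ⟨x, rfl⟩ := (DGL.toHomology_bijective (DGL.triv V) n).2 x
  obtain ⟨c, rfl⟩ := (DGL.triv V).cls_surjective n x
  refine (DGL.homologyMap_toHomology (K := DGL.triv V) (L := DGL.triv W) φ n _).trans ?_
  refine Eq.trans ?_
    (DGL.homologyMap_toHomology (K := DGL.triv V) (L := DGL.triv W) ψ n _).symm
  exact congrArg _ (((DGL.triv W).cls_eq_iff n _ _).2 (h c))

/-- A chain map that is zero on homology is null-homotopic. -/
lemma exists_nullHomotopy {V W : RatComplex.{u}} (φ : V ⟶ W)
    (h : ∀ n (c : (DGL.triv V).cyc n), (φ.f n).hom c.1 ∈ (DGL.triv W).bdry n) :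
    ∃ s : ∀ n : ℕ, V.X n →ₗ[ℚ] W.X (n + 1), 
      (∀ n (x : V.X (n + 1)), (φ.f (n + 1)).hom x =
        (W.d (n + 2) (n + 1)).hom (s (n + 1) x) + s n ((V.d (n + 1) n).hom x)) ∧
      ∀ x : V.X 0, (φ.f 0).hom x = (W.d 1 0).hom (s 0 x) := by
  obtain ⟨S⟩ := (inferInstance : Nonempty (RatComplex.Splitting V))
  obtain ⟨T⟩ := (inferInstance : Nonempty (RatComplex.Splitting W))
  have he : ∀ n (x : V.X n), (W.d (n + 1) n).hom (T.h n (n + 1) ((φ.f n).hom (S.e n x))) =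
      (φ.f n).hom (S.e n x) := fun n x => by
    obtain ⟨z, hz⟩ := h n (S.eCyc n x)
    have hz' : (W.d (n + 1) n).hom z = (φ.f n).hom (S.e n x) := hz
    rw [← hz', T.d_h_d]
  -- The first summand bounds `φ e`, whose values are boundaries; the second contributes `φ (∂ h + h
  -- ∂) = φ θ`. Together they give `φ`, as `e + θ = 1`.
  refine ⟨fun n => T.h n (n + 1) ∘ₗ (φ.f n).hom ∘ₗ S.e n + (φ.f (n + 1)).hom ∘ₗ S.h n (n + 1),
    fun n x => ?_, fun x => ?_⟩
  · simp only [LinearMap.add_apply, LinearMap.comp_apply]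
    rw [map_add, he, S.e_d, map_zero, map_zero, zero_add, ← DGL.map_d, add_assoc, ← map_add, ← map_add]
    congr 1
    rw [S.e_apply, S.θ_apply]
    exact (sub_add_cancel x _).symm
  · simp only [LinearMap.add_apply, LinearMap.comp_apply]
    rw [map_add, he, ← DGL.map_d, ← map_add]
    congr 1
    rw [S.e_apply, S.θ_apply, DGL.d_apply_zero, map_zero]
    abel

lemma homPre_mem_homBdry {V W : RatComplex.{u}} (φ : V ⟶ W)
    (h : ∀ n (c : (DGL.triv V).cyc n), (φ.f n).hom c.1 ∈ (DGL.triv W).bdry n)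
    (M : RatComplex.{u}) (t : ℤ) (f : HomFamily W M) (hf : f ∈ homCyc W M t) :
    homPre φ M f ∈ homBdry V M t := by
  obtain ⟨s, hs⟩ := exists_nullHomotopy φ h
  have hf1 : ∀ i j, (M.d (j + 1) j).hom ∘ₗ f i (j + 1)
      = ((t.negOnePow : ℤˣ) : ℤ) • (f (i - 1) j ∘ₗ (W.d i (i - 1)).hom) := fun i j =>
    sub_eq_zero.1 (congrFun (congrFun (show homD W M t f = 0 from hf.2) i) j)
  have hsq : ((t.negOnePow : ℤˣ) : ℤ) * ((t.negOnePow : ℤˣ) : ℤ) = 1 := by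
    rw [← Units.val_mul, Int.units_mul_self, Units.val_one]
  -- The witness is `f ∘ s`, of degree `t + 1`. The factor `(-1)^t` absorbs the sign from moving `∂`
  -- past `f`.
  refine ⟨fun i j => ((t.negOnePow : ℤˣ) : ℤ) • (f (i + 1) j ∘ₗ s i), fun i j hij => ?_, ?_⟩
  · have := hf.1 (i + 1) j (by push_cast; omega)
    simp [this]
  · funext i j
    refine LinearMap.ext fun x => ?_
    have h1 : (M.d (j + 1) j).hom (f (i + 1) (j + 1) (s i x)) =
        ((t.negOnePow : ℤˣ) : ℤ) • f i j ((W.d (i + 1) i).hom (s i x)) :=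
      congrArg (fun g => g (s i x)) (hf1 (i + 1) j)
    change (M.d (j + 1) j).hom (((t.negOnePow : ℤˣ) : ℤ) • (f (i + 1) (j + 1) (s i x))) -
      (((t + 1).negOnePow : ℤˣ) : ℤ) • (((t.negOnePow : ℤˣ) : ℤ) •
        f (i - 1 + 1) j (s (i - 1) ((V.d i (i - 1)).hom x))) = f i j ((φ.f i).hom x)
    rw [map_zsmul, h1, Int.negOnePow_succ, Units.val_neg, smul_smul, smul_smul, neg_mul, hsq,
      one_smul, neg_smul, one_smul, sub_neg_eq_add]
    rcases i with _ | i
    · rw [DGL.d_apply_zero, map_zero, map_zero, add_zero, hs.2]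
    · refine Eq.trans ?_ (congrArg (f (i + 1) j) (hs.1 i x)).symm
      exact (map_add (f (i + 1) j) _ _).symm

lemma hoHom_map_eq_of_sub_mem_bdry {V W : RatComplex.{u}} {φ ψ : V ⟶ W}
    (h : ∀ n (c : (DGL.triv V).cyc n),
      (φ.f n).hom c.1 - (ψ.f n).hom c.1 ∈ (DGL.triv W).bdry n) (M : RatComplex.{u}) (t : ℤ) :
    (hoHom M t).map φ.op = (hoHom M t).map ψ.op := by
  ext : 1
  apply Submodule.linearMap_qext
  refine LinearMap.ext fun f => (Submodule.Quotient.eq _).2 ?_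
  have := homPre_mem_homBdry (φ - ψ) h M t f.1 f.2
  have h2 : homPre (φ - ψ) M f.1 = homPre φ M f.1 - homPre ψ M f.1 := by
    funext i j
    exact LinearMap.ext fun x => map_sub (f.1 i j) _ _
  rwa [h2] at this

namespace DGL

/-! ### Weak equivalences and homology -/

/-- A DGL morphism that is bijective in every degree is an isomorphism. -/
lemma nonempty_iso {K L : DGL.{u}} (F : K ⟶ L)
    (h : ∀ n, Function.Bijective ((Hom.f F).f n).hom) : Nonempty (K ≅ L) := by
  have (n : ℕ) : IsIso ((Hom.f F).f n) := (ConcreteCategory.isIso_iff_bijective _).2 (h n)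
  have : IsIso (Hom.f F) := HomologicalComplex.Hom.isIso_of_components _
  have h1 : ∀ n x, ((inv (Hom.f F)).f n).hom (((Hom.f F).f n).hom x) = x := fun n x =>
    congrArg (fun g : K.X ⟶ K.X => (g.f n).hom x) (IsIso.hom_inv_id (Hom.f F))
  have h2 : ∀ n x, ((Hom.f F).f n).hom (((inv (Hom.f F)).f n).hom x) = x := fun n x =>
    congrArg (fun g : L.X ⟶ L.X => (g.f n).hom x) (IsIso.inv_hom_id (Hom.f F))
  refine ⟨⟨F, ⟨inv (Hom.f F), fun p q r x y => ?_⟩, hom_ext h1, hom_ext h2⟩⟩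
  apply (h r).1
  rw [h2, Hom.map_bracket, h2, h2]

lemma nonempty_homologyDGL_iso_of_quasiIso {K L : DGL.{u}} (F : K ⟶ L)
    (hF : QuasiIso (toComplex.map F)) : Nonempty (K.homologyDGL ≅ L.homologyDGL) :=
  nonempty_iso (homologyDGLFunctor.map F) fun n =>
    (isIso_homologyMap_iff (Hom.f F) n).1 ((quasiIsoAt_iff_isIso_homologyMap _ n).1
      (hF.quasiIsoAt n))

/-- Weakly equivalent DGLs have isomorphic homology. -/
theorem WeaklyEquivalent.nonempty_homologyDGL_iso {K L : DGL.{u}} (h : WeaklyEquivalent K L) :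
    Nonempty (K.homologyDGL ≅ L.homologyDGL) := by
  induction h with
  | rel K L h =>
    obtain ⟨F, hF⟩ := h
    exact nonempty_homologyDGL_iso_of_quasiIso F hF
  | refl K => exact ⟨Iso.refl _⟩
  | symm K L _ h => exact h.map Iso.symm
  | trans K L M _ _ h h' => exact ⟨h.some ≪≫ h'.some⟩

/-- With zero differential every element is a cycle and only zero is a boundary. -/
lemma nonempty_homologyDGL_homologyDGL_iso (L : DGL.{u}) :
    Nonempty (L.homologyDGL.homologyDGL ≅ L.homologyDGL) := by
  let G := L.homologyDGL
  have hc : ∀ n (x : G.X.X n), x ∈ G.cyc n := fun n x => rfl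
  have hb : ∀ n (x : G.X.X n), x ∈ G.bdry n → x = 0 := by
    rintro n _ ⟨y, rfl⟩
    rfl
  obtain ⟨a⟩ := nonempty_iso G.cyclesIncl fun n =>
    ⟨Subtype.val_injective, fun x => ⟨⟨x, hc n x⟩, rfl⟩⟩
  obtain ⟨b⟩ := nonempty_iso G.cyclesProj fun n => ⟨(injective_iff_map_eq_zero (G.cls n)).2
    fun x hx => Subtype.ext (hb n _ ((G.cls_eq_zero_iff n x).1 hx)), G.cls_surjective n⟩
  exact ⟨b.symm ≪≫ a⟩

/-! ### The homology of a simplicial resolution -/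

/-- The homology of the underlying complex of a DGL in one degree, as a functor. -/
def HmodFunctor (t : ℕ) : DGL.{u} ⥤ ModuleCat.{u} ℚ where
  obj K := ModuleCat.of ℚ (K.Hmod t)
  map F := ModuleCat.ofHom (Hmap (Hom.f F) t)
  map_id _ := ModuleCat.hom_ext (Hmod_ext fun _ => rfl)
  map_comp _ _ := ModuleCat.hom_ext (Hmod_ext fun _ => rfl)

/-- The comparison of the two descriptions of homology. -/
def HmodFunctorIso (t : ℕ) : HmodFunctor.{u} t ≅
    toComplex ⋙ HomologicalComplex.homologyFunctor (ModuleCat.{u} ℚ) (ComplexShape.down ℕ) t :=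
  NatIso.ofComponents
    (fun K => (LinearEquiv.ofBijective _ (K.toHomology_bijective t)).toModuleIso)
    (fun F => ModuleCat.hom_ext (LinearMap.ext fun x =>
      (homologyMap_toHomology (Hom.f F) t x).symm))

end DGL

/-- A map to a constant simplicial vector space that is an isomorphism on homotopy groups makes
the alternating face map complex into a resolution. -/
theorem SimplicialObject.relativelyExact_of_isIso {X : SimplicialObject (ModuleCat.{u} ℚ)}
    {T : ModuleCat.{u} ℚ} (η : X ⟶ (SimplicialObject.const _).obj T)
    (h : ∀ s, IsIso (HomologicalComplex.homologyMap
      ((alternatingFaceMapComplex (ModuleCat.{u} ℚ)).map η) s)) :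
    RelativelyExact (𝟭 (ModuleCat.{u} ℚ)) ((alternatingFaceMapComplex _).obj X)
      (η.app (op ⦋0⦌)) := by
  let P : RatComplex.{u} := (alternatingFaceMapComplex (ModuleCat.{u} ℚ)).obj X
  let C : RatComplex.{u} := (alternatingFaceMapComplex (ModuleCat.{u} ℚ)).obj
    ((SimplicialObject.const _).obj T)
  let φ : P ⟶ C := (alternatingFaceMapComplex (ModuleCat.{u} ℚ)).map η
  have hφ : ∀ s, Function.Bijective (DGL.Hmap (K := DGL.triv P) (L := DGL.triv C) φ s) :=
    fun s => (DGL.isIso_homologyMap_iff (K := DGL.triv P) (L := DGL.triv C) φ s).1 (h s)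
  -- All faces are identities, so the alternating sum is alternately 0 and 1. Hence the constant
  -- object has homology only in degree zero.
  have hCd : ∀ n (y : T), (C.d (n + 1) n).hom y = if Even n then 0 else y := fun n y => by
    have h1 : C.d (n + 1) n = ∑ i : Fin (n + 2), (-1 : ℤ) ^ (i : ℕ) • 𝟙 T :=
      alternatingFaceMapComplex_obj_d _ n
    rw [h1, ← Finset.sum_smul, Fin.sum_univ_eq_sum_range (fun i => (-1 : ℤ) ^ i),
      neg_one_geom_sum]
    simp only [Nat.even_add, even_two, iff_true]
    split_ifs
    · rw [zero_smul]; rfl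
    · rw [one_smul]; rfl
  have hC0 : ∀ y : T, y ∈ (DGL.triv C).bdry 0 → y = 0 := by
    rintro _ ⟨z, rfl⟩
    exact hCd 0 z
  have hCs : ∀ n (y : T), (C.d (n + 1) n).hom y = 0 → y ∈ (DGL.triv C).bdry (n + 1) := by
    intro n y hy
    by_cases hn : Even n
    · refine ⟨y, (hCd (n + 1) y).trans (if_neg ?_)⟩
      simpa [Nat.even_add_one] using hn
    · have : y = 0 := ((hCd n y).trans (if_neg hn)).symm.trans hy
      rw [this]
      exact zero_mem _
  have hP0 : ∀ x : P.X 0, (φ.f 0).hom x = 0 → x ∈ (DGL.triv P).bdry 0 := fun x hx => by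
    have hx' : x ∈ (DGL.triv P).cyc 0 := DGL.d_apply_zero P x
    refine ((DGL.triv P).cls_eq_zero_iff 0 ⟨x, hx'⟩).1 ((injective_iff_map_eq_zero _).1
      (hφ 0).1 _ ?_)
    refine ((DGL.triv C).cls_eq_zero_iff 0 _).2 ?_
    change (φ.f 0).hom x ∈ _
    rw [hx]
    exact zero_mem _
  have hPs : ∀ n (x : P.X (n + 1)), (P.d (n + 1) n).hom x = 0 →
      x ∈ (DGL.triv P).bdry (n + 1) := fun n x hx => by
    refine ((DGL.triv P).cls_eq_zero_iff (n + 1) ⟨x, hx⟩).1 ((injective_iff_map_eq_zero _).1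
      (hφ (n + 1)).1 _ ?_)
    refine ((DGL.triv C).cls_eq_zero_iff (n + 1) _).2 (hCs n _ ?_)
    refine (DGL.map_d φ (n + 1) n x).symm.trans ?_
    rw [hx, map_zero]
  -- A pseudo-inverse of `a` turns elementwise solvability into a linear solution; this upgrades
  -- exactness to relative exactness.
  have lift : ∀ {Y U V : ModuleCat.{u} ℚ} (a : U ⟶ V) (f : Y ⟶ V),
      (∀ y, ∃ x, a.hom x = f.hom y) → ∃ g : Y ⟶ U, g ≫ a = f := fun a f hf => by
    obtain ⟨g, hg⟩ := LinearMap.exists_comp_comp_self a.hom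
    refine ⟨f ≫ ModuleCat.ofHom g, ModuleCat.hom_ext (LinearMap.ext fun y => ?_)⟩
    obtain ⟨x, hx⟩ := hf y
    change a.hom (g (f.hom y)) = f.hom y
    rw [← hx, hg]
  refine ⟨?_, fun Y g => ?_, fun Y f hf => ?_, fun n Y f hf => ?_⟩
  · refine (φ.comm 1 0).symm.trans ?_
    refine ModuleCat.hom_ext (LinearMap.ext fun x => ?_)
    exact hCd 0 _
  · refine lift (U := P.X 0) (V := T) (φ.f 0) g fun y => ?_
    obtain ⟨z, hz⟩ := (hφ 0).2 ((DGL.triv C).cls 0 ⟨g.hom y, DGL.d_apply_zero C _⟩)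
    obtain ⟨x, rfl⟩ := (DGL.triv P).cls_surjective 0 z
    refine ⟨x.1, sub_eq_zero.1 (hC0 _ ?_)⟩
    exact ((DGL.triv C).cls_eq_iff 0 _ _).1 hz
  · refine lift (P.d 1 0) f fun y => ?_
    exact hP0 _ (congrArg (fun g => g.hom y) hf)
  · refine lift (P.d (n + 2) (n + 1)) f fun y => ?_
    exact hPs n _ (congrArg (fun g => g.hom y) hf)

/-- The target of the augmentation may be replaced by an isomorphic object. -/
def SimplicialContraction.ofIso {C : Type w} [Category.{v} C] {D : Type w} [Category.{v} D] {J : C ⥤ D}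
    {X : SimplicialObject C} {G G' : D} {ε : J.obj (X _⦋0⦌) ⟶ G} {Y : C}
    (S : SimplicialContraction J X ε Y) (e : G ≅ G') :
    SimplicialContraction J X (ε ≫ e.hom) Y where
  bot g := S.bot (g ≫ e.inv)
  h := S.h
  map_bot g := by
    rw [← Category.assoc, S.map_bot, Category.assoc, e.inv_hom_id, Category.comp_id]
  h_δ_zero := S.h_δ_zero
  h_δ_one f := by
    rw [S.h_δ_one, Category.assoc, Category.assoc, e.hom_inv_id, Category.comp_id]
  h_δ_succ := S.h_δ_succ

/-! ### Free DGLs and maps of their homology -/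

/-- A free DGL with a choice of generators. -/
structure FreeDGL : Type (u + 1) where
  toDGL : DGL.{u}
  V : RatComplex.{u}
  ι : V ⟶ toDGL.X
  isFreeOn : DGL.IsFreeOn (L := toDGL) ι

namespace FreeDGL

/-- The category of free DGLs and morphisms of their homology. -/
instance : Category.{u} FreeDGL.{u} where
  Hom Y Z := Y.toDGL.homologyDGL ⟶ Z.toDGL.homologyDGL
  id Y := 𝟙 Y.toDGL.homologyDGL
  comp f g := CategoryStruct.comp (obj := DGL.{u}) f g
  id_comp f := Category.id_comp (obj := DGL.{u}) f
  comp_id f := Category.comp_id (obj := DGL.{u}) f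
  assoc f g h := Category.assoc (obj := DGL.{u}) f g h

/-- Homology, as a functor to DGLs. -/
def homology : FreeDGL.{u} ⥤ DGL.{u} where
  obj Y := Y.toDGL.homologyDGL
  map f := f

/-- The homology classes of the generators. -/
def gen (Y : FreeDGL.{u}) (n : ℕ) : (DGL.triv Y.V).Hmod n →ₗ[ℚ] Y.toDGL.Hmod n :=
  DGL.Hmap (K := DGL.triv Y.V) (L := Y.toDGL) Y.ι n

/-- The map in degree `n` underlying a map of homology DGLs. -/
def component {K L : DGL.{u}} (φ : K.homologyDGL ⟶ L.homologyDGL) (n : ℕ) :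
    K.Hmod n →ₗ[ℚ] L.Hmod n :=
  ((DGL.Hom.f φ).f n).hom

lemma component_comp {K L M : DGL.{u}} (φ : K.homologyDGL ⟶ L.homologyDGL)
    (ψ : L.homologyDGL ⟶ M.homologyDGL) (n : ℕ) :
    component (φ ≫ ψ) n = component ψ n ∘ₗ component φ n := rfl

lemma homology_hom_ext (Y : FreeDGL.{u}) {K : DGL.{u}}
    {φ ψ : Y.toDGL.homologyDGL ⟶ K.homologyDGL}
    (h : ∀ n, component φ n ∘ₗ Y.gen n = component ψ n ∘ₗ Y.gen n) : φ = ψ :=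
  Y.isFreeOn.homologyDGL_hom_ext fun n c => congrArg (fun f => f c) (h n)

lemma exists_map (Y : FreeDGL.{u}) (K : DGL.{u})
    (l : ∀ n, (DGL.triv Y.V).Hmod n →ₗ[ℚ] K.Hmod n) : ∃ F : Y.toDGL ⟶ K,
      ∀ n, component (DGL.homologyDGLFunctor.map F) n ∘ₗ Y.gen n = l n := by
  obtain ⟨F, hF⟩ := Y.isFreeOn.exists_hom K l
  exact ⟨F, fun n => LinearMap.ext (hF n)⟩

/-- Morphisms of `FreeDGL` are therefore realized by DGL maps, and an invariant functor does not see
the choice. -/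
lemma exists_map_eq (Y : FreeDGL.{u}) {K : DGL.{u}} (φ : Y.toDGL.homologyDGL ⟶ K.homologyDGL) :
    ∃ F : Y.toDGL ⟶ K, DGL.homologyDGLFunctor.map F = φ := by
  obtain ⟨F, hF⟩ := Y.exists_map K fun n => component φ n ∘ₗ Y.gen n
  exact ⟨F, Y.homology_hom_ext hF⟩

/-- The extension of a family of linear maps on the homology of the generators. -/
def ext (Y : FreeDGL.{u}) (K : DGL.{u})
    (l : ∀ n, (DGL.triv Y.V).Hmod n →ₗ[ℚ] K.Hmod n) : Y.toDGL.homologyDGL ⟶ K.homologyDGL :=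
  DGL.homologyDGLFunctor.map (Y.exists_map K l).choose

lemma component_ext (Y : FreeDGL.{u}) (K : DGL.{u})
    (l : ∀ n, (DGL.triv Y.V).Hmod n →ₗ[ℚ] K.Hmod n) (n : ℕ) :
    component (Y.ext K l) n ∘ₗ Y.gen n = l n :=
  (Y.exists_map K l).choose_spec n

lemma ext_comp (Y : FreeDGL.{u}) {K L : DGL.{u}}
    (l : ∀ n, (DGL.triv Y.V).Hmod n →ₗ[ℚ] K.Hmod n) (φ : K.homologyDGL ⟶ L.homologyDGL)
    (ψ : Y.toDGL.homologyDGL ⟶ L.homologyDGL)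
    (h : ∀ n, component φ n ∘ₗ l n = component ψ n ∘ₗ Y.gen n) : Y.ext K l ≫ φ = ψ :=
  Y.homology_hom_ext fun n => by
    rw [component_comp, LinearMap.comp_assoc, component_ext, h]

/-- A functor on DGLs is invariant if maps out of free DGLs that agree on homology have the
same image. -/
def Invariant {C : Type*} [Category* C] (Φ : DGL.{u} ⥤ C) : Prop :=
  ∀ (Y : FreeDGL.{u}) {K : DGL.{u}} {F G : Y.toDGL ⟶ K},
    DGL.homologyDGLFunctor.map F = DGL.homologyDGLFunctor.map G → Φ.map F = Φ.map G

section Lift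

variable {C : Type*} [Category* C] {Φ : DGL.{u} ⥤ C} (hΦ : Invariant Φ)

/-- The functor induced by an invariant functor. -/
def lift : FreeDGL.{u} ⥤ C where
  obj Y := Φ.obj Y.toDGL
  map {Y Z} f := Φ.map (Y.exists_map_eq f).choose
  map_id Y := by
    rw [← Φ.map_id]
    refine hΦ Y ((Y.exists_map_eq (K := Y.toDGL) (𝟙 Y)).choose_spec.trans ?_)
    exact (CategoryTheory.Functor.map_id DGL.homologyDGLFunctor Y.toDGL).symm
  map_comp {Y Z W} f g := by
    rw [← Φ.map_comp]
    refine hΦ Y ((Y.exists_map_eq (K := W.toDGL) (f ≫ g)).choose_spec.trans ?_)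
    rw [Functor.map_comp, (Y.exists_map_eq (K := Z.toDGL) f).choose_spec,
      (Z.exists_map_eq (K := W.toDGL) g).choose_spec]
    rfl

lemma lift_map {Y Z : FreeDGL.{u}} (F : Y.toDGL ⟶ Z.toDGL) :
    (lift hΦ).map (X := Y) (Y := Z) (DGL.homologyDGLFunctor.map F) = Φ.map F :=
  hΦ Y (Y.exists_map_eq (DGL.homologyDGLFunctor.map F)).choose_spec

end Lift

/-! ### Simplicial resolutions -/

section Simplicial

variable (A : SimplicialObject DGL.{u}) {V : ℕ → RatComplex.{u}}
  {ι : ∀ n, V n ⟶ DGL.toComplex.obj (A _⦋n⦌)} (hι : ∀ n, DGL.IsFreeOn (ι n))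

/-- A dimensionwise free simplicial DGL, as a simplicial object of `FreeDGL`. -/
def simplicial : SimplicialObject FreeDGL.{u} where
  obj n := ⟨A.obj n, V n.unop.len, ι n.unop.len, hι n.unop.len⟩
  map f := DGL.homologyDGLFunctor.map (A.map f)
  map_id _ := (congrArg _ (A.map_id _)).trans (DGL.homologyDGLFunctor.map_id _)
  map_comp _ _ := (congrArg _ (A.map_comp _ _)).trans (DGL.homologyDGLFunctor.map_comp _ _)

/-- Applying the functor induced by an invariant functor to the simplicial object of `FreeDGL`. -/
def simplicialCompLift {C : Type*} [Category* C] {Φ : DGL.{u} ⥤ C} (hΦ : Invariant Φ) :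
    simplicial A hι ⋙ lift hΦ ≅ A ⋙ Φ :=
  NatIso.ofComponents (fun _ => Iso.refl _) fun {X Y} f => by
    refine (Category.comp_id _).trans (Eq.trans ?_ (Category.id_comp _).symm)
    exact lift_map hΦ (Y := (simplicial A hι).obj X) (Z := (simplicial A hι).obj Y) (A.map f)

variable {A} {L : DGL.{u}} (ε : A ⟶ (SimplicialObject.const DGL.{u}).obj L)

/-- The augmentation in simplicial dimension zero. -/
abbrev aug : homology.obj ((simplicial A hι) _⦋0⦌) ⟶ L.homologyDGL :=
  DGL.homologyDGLFunctor.map (ε.app (op ⦋0⦌))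

lemma aug_comp : homology.map ((simplicial A hι).δ 0) ≫ aug hι ε =
    homology.map ((simplicial A hι).δ 1) ≫ aug hι ε := by
  change DGL.homologyDGLFunctor.map (A.δ 0) ≫ DGL.homologyDGLFunctor.map (ε.app (op ⦋0⦌)) =
    DGL.homologyDGLFunctor.map (A.δ 1) ≫ DGL.homologyDGLFunctor.map (ε.app (op ⦋0⦌))
  rw [← Functor.map_comp, ← Functor.map_comp]
  have h (i : Fin 2) : A.δ i ≫ ε.app (op ⦋0⦌) = ε.app (op ⦋1⦌) :=
    (ε.naturality (SimplexCategory.δ i).op).trans (Category.comp_id _)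
  rw [h, h]

/-- For each `t` this is `SimplicialObject.exists_contraction` applied to the simplicial vector
space `H_t(A_•)` over `H_t(L)`. The resulting maps are only linear and need not respect brackets. -/
lemma exists_contraction (h : DGL.IsFreeResolution ε) (t : ℕ) :
    ∃ (b : L.Hmod t →ₗ[ℚ] DGL.Hmod (A _⦋0⦌) t)
      (s : ∀ n, DGL.Hmod (A _⦋n⦌) t →ₗ[ℚ] DGL.Hmod (A _⦋n + 1⦌) t),
      DGL.Hmap (DGL.Hom.f (ε.app (op ⦋0⦌))) t ∘ₗ b = LinearMap.id ∧
      (∀ n, DGL.Hmap (DGL.Hom.f (A.δ (0 : Fin (n + 2)))) t ∘ₗ s n = LinearMap.id) ∧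
      DGL.Hmap (DGL.Hom.f (A.δ 1)) t ∘ₗ s 0 =
        b ∘ₗ DGL.Hmap (DGL.Hom.f (ε.app (op ⦋0⦌))) t ∧
      ∀ n (i : Fin (n + 2)), DGL.Hmap (DGL.Hom.f (A.δ i.succ)) t ∘ₗ s (n + 1) =
        s n ∘ₗ DGL.Hmap (DGL.Hom.f (A.δ i)) t := by
  let W := (SimplicialObject.whiskering DGL.{u} (ModuleCat.{u} ℚ)).obj (DGL.HmodFunctor t)
  let κ : W.obj ((SimplicialObject.const DGL.{u}).obj L) ≅
      (SimplicialObject.const _).obj ((DGL.HmodFunctor t).obj L) :=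
    Functor.constComp _ L (DGL.HmodFunctor t)
  let η : W.obj A ⟶ (SimplicialObject.const _).obj ((DGL.HmodFunctor t).obj L) := W.map ε ≫ κ.hom
  have hη : ∀ s, IsIso (HomologicalComplex.homologyMap
      ((alternatingFaceMapComplex (ModuleCat.{u} ℚ)).map η) s) := fun s => by
    let α : W ⋙ alternatingFaceMapComplex (ModuleCat.{u} ℚ) ⋙
        HomologicalComplex.homologyFunctor _ _ s ≅
        (SimplicialObject.whiskering _ _).obj DGL.toComplex ⋙ piH s t :=
      Functor.isoWhiskerRight ((SimplicialObject.whiskering DGL.{u} (ModuleCat.{u} ℚ)).mapIso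
        (DGL.HmodFunctorIso t)) (alternatingFaceMapComplex (ModuleCat.{u} ℚ) ⋙
          HomologicalComplex.homologyFunctor _ _ s)
    let Ψ := alternatingFaceMapComplex (ModuleCat.{u} ℚ) ⋙
      HomologicalComplex.homologyFunctor _ _ s
    have h1 : IsIso (Ψ.map (W.map ε)) := (NatIso.isIso_map_iff α ε).2 (h.isIso s t)
    have h2 : Ψ.map η = Ψ.map (W.map ε) ≫ Ψ.map κ.hom := Ψ.map_comp _ _
    change IsIso (Ψ.map η)
    rw [h2]
    infer_instance
  obtain ⟨b, s, h1, h2, h3, h4⟩ := SimplicialObject.exists_contraction (W.obj A) _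
    (SimplicialObject.relativelyExact_of_isIso η hη)
  exact ⟨b.hom, fun n => (s n).hom, congrArg ModuleCat.Hom.hom h1,
    fun n => congrArg ModuleCat.Hom.hom (h2 n), congrArg ModuleCat.Hom.hom h3,
    fun n i => congrArg ModuleCat.Hom.hom (h4 n i)⟩

/-- The simplicial sets of maps into a resolution are contractible. -/
theorem nonempty_simplicialContraction (h : DGL.IsFreeResolution ε) (Y : FreeDGL.{u}) :
    Nonempty (SimplicialContraction homology (simplicial A hι) (aug hι ε) Y) := by
  choose b s h1 h2 h3 h4 using exists_contraction ε h
  -- A linear contraction suffices: it is applied to the images of the generators only, and the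
  -- result is extended to a map of Lie algebras. The face identities need checking only on
  -- generators.
  refine ⟨⟨fun g => Y.ext (A _⦋0⦌) fun n => b n ∘ₗ component g n ∘ₗ Y.gen n,
    fun n f => Y.ext (A _⦋n + 1⦌) fun t => s t n ∘ₗ component f t ∘ₗ Y.gen t,
    fun g => ?_, fun n f => ?_, fun f => ?_, fun n f i => ?_⟩⟩
  · refine Y.ext_comp _ (aug hι ε) g fun t => ?_
    exact congrArg (· ∘ₗ (component g t ∘ₗ Y.gen t)) (h1 t)
  · refine Y.ext_comp _ (DGL.homologyDGLFunctor.map (A.δ 0)) f fun t => ?_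
    exact congrArg (· ∘ₗ (component f t ∘ₗ Y.gen t)) (h2 t n)
  · refine Y.ext_comp _ (DGL.homologyDGLFunctor.map (A.δ 1)) _ fun t => ?_
    rw [component_ext]
    exact congrArg (· ∘ₗ (component f t ∘ₗ Y.gen t)) (h3 t)
  · refine Y.ext_comp _ (DGL.homologyDGLFunctor.map (A.δ i.succ)) _ fun t => ?_
    rw [component_ext]
    exact congrArg (· ∘ₗ (component f t ∘ₗ Y.gen t)) (h4 t n i)

/-- The alternating face map complex of a free resolution is a resolution of the homology. -/
theorem relativelyExact (h : DGL.IsFreeResolution ε) {G : DGL.{u}} (e : L.homologyDGL ≅ G) :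
    RelativelyExact (Free.mapFunctor homology) (G := Free.of ℤ G)
      (SimplicialContraction.freeComplex (simplicial A hι))
      ((Free.embedding ℤ DGL).map (aug hι ε ≫ e.hom)) := by
  refine SimplicialContraction.relativelyExact ?_ fun Y => Nonempty.some ?_
  · refine (Category.assoc _ _ _).symm.trans (Eq.trans ?_ (Category.assoc _ _ _))
    exact congrArg (· ≫ e.hom) (aug_comp hι ε)
  · obtain ⟨S⟩ := nonempty_simplicialContraction hι ε h Y
    exact ⟨S.ofIso e⟩

end Simplicial

end FreeDGL

/-! ### Comparison of resolutions under invariant functors -/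

namespace FreeDGL

lemma invariant_ab_homology (t : ℕ) : Invariant (DGL.ab.{u} ⋙
    HomologicalComplex.homologyFunctor (ModuleCat.{u} ℚ) (ComplexShape.down ℕ) t) :=
  fun Y _ _ _ h => homologyMap_eq_of_sub_mem_bdry t (Y.isFreeOn.ab_sub_mem_bdry h t)

/-- Passing to the opposite of `ModuleCat ℚ` makes this contravariant functor covariant, so the
comparison for homology covers cohomology too. -/
lemma invariant_ab_hoHom (M : RatComplex.{u}) (t : ℤ) :
    Invariant (DGL.ab.{u} ⋙ (hoHom M t).rightOp) :=
  fun Y _ _ _ h => congrArg Quiver.Hom.op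
    (hoHom_map_eq_of_sub_mem_bdry (Y.isFreeOn.ab_sub_mem_bdry h) M t)

section

variable {C : Type (u + 1)} [Category.{u} C] [Preadditive C]
  {Φ : DGL.{u} ⥤ C}

/-- The value of an invariant functor on a simplicial free DGL is computed by the additive
extension of the functor. -/
def freeComplexIso (hΦ : Invariant Φ) (A : SimplicialObject DGL.{u}) {V : ℕ → RatComplex.{u}}
    {ι : ∀ n, V n ⟶ DGL.toComplex.obj (A _⦋n⦌)} (hι : ∀ n, DGL.IsFreeOn (ι n)) :
    ((Free.lift ℤ (lift hΦ)).mapHomologicalComplex _).obj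
      (SimplicialContraction.freeComplex (simplicial A hι)) ≅
    (alternatingFaceMapComplex C).obj (((SimplicialObject.whiskering _ _).obj Φ).obj A) :=
  eqToIso (Functor.congr_obj (map_alternatingFaceMapComplex
    (Free.lift ℤ (lift hΦ))) _) ≪≫
  (alternatingFaceMapComplex C).mapIso
    (Functor.isoWhiskerLeft (simplicial A hι) (Free.embeddingLiftIso ℤ (lift hΦ)) ≪≫
      simplicialCompLift A hι hΦ)

/-- Invariant functors take free resolutions of DGLs with isomorphic homology to homotopy
equivalent complexes. -/
theorem nonempty_homotopyEquiv (hΦ : Invariant Φ) {L L' : DGL.{u}} (e : L'.homologyDGL ≅ L.homologyDGL)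
    {A A' : SimplicialObject DGL.{u}} {ε : A ⟶ (SimplicialObject.const DGL.{u}).obj L}
    {ε' : A' ⟶ (SimplicialObject.const DGL.{u}).obj L'}
    (hA : DGL.IsFreeResolution ε) (hA' : DGL.IsFreeResolution ε') :
    Nonempty (HomotopyEquiv
      ((alternatingFaceMapComplex C).obj (((SimplicialObject.whiskering _ _).obj Φ).obj A))
      ((alternatingFaceMapComplex C).obj (((SimplicialObject.whiskering _ _).obj Φ).obj A'))) := by
  obtain ⟨V, ι, hι, -⟩ := hA.free
  obtain ⟨V', ι', hι', -⟩ := hA'.free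
  -- The isomorphism `e` lets both complexes resolve the same object `H(L)`; the equivalence is
  -- found in `Free ℤ FreeDGL`, before the functor is applied.
  obtain ⟨E⟩ := (relativelyExact hι ε hA (Iso.refl _)).nonempty_homotopyEquiv
    (relativelyExact hι' ε' hA' e)
  exact ⟨(HomotopyEquiv.ofIso (freeComplexIso hΦ A hι).symm).trans
    (((Free.lift ℤ (lift hΦ)).mapHomotopyEquiv E).trans
      (HomotopyEquiv.ofIso (freeComplexIso hΦ A' hι')))⟩

end

end FreeDGL

/-- The alternating coface map complex, as the opposite of an alternating face map complex. -/
def alternatingCofaceMapComplexIso {C : Type*} [Category* C] [Preadditive C]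
    (X : CosimplicialObject C) : (alternatingCofaceMapComplex C).obj X ≅
      ((alternatingFaceMapComplex Cᵒᵖ).obj
        ((cosimplicialSimplicialEquiv C).functor.obj (op X))).unop :=
  HomologicalComplex.Hom.isoOfComponents (fun _ => Iso.refl _) (by
    rintro n _ rfl
    refine (Category.id_comp _).trans (Eq.trans ?_ (Category.comp_id _).symm)
    refine Eq.trans ?_ (CochainComplex.of_d _ _ _).symm
    have h := alternatingFaceMapComplex_obj_d
      ((cosimplicialSimplicialEquiv C).functor.obj (op X)) n
    exact (congrArg Quiver.Hom.unop h).trans (AlternatingCofaceMapComplex.d_eq_unop_d _ n).symm)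

/-- The cohomology of a cosimplicial object, as the homology of the opposite simplicial object. -/
def alternatingCofaceMapComplexHomologyIso {C : Type*} [Category* C] [Abelian C]
    (X : CosimplicialObject C) (Y : SimplicialObject Cᵒᵖ)
    (e : Y ≅ (cosimplicialSimplicialEquiv C).functor.obj (op X)) (n : ℕ) :
    ((alternatingCofaceMapComplex C).obj X).homology n ≅
      (((alternatingFaceMapComplex Cᵒᵖ).obj Y).homology n).unop :=
  HomologicalComplex.homologyMapIso (alternatingCofaceMapComplexIso X) n ≪≫
    HomologicalComplex.homologyUnop _ n ≪≫
    (HomologicalComplex.homologyMapIso ((alternatingFaceMapComplex Cᵒᵖ).mapIso e) n).unop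

/-- The cosimplicial vector space computing cohomology, as a simplicial object of the opposite
category. -/
def cosimplicialHoHomIso (A : SimplicialObject DGL.{u}) (M : RatComplex.{u}) (t : ℤ) :
    ((SimplicialObject.whiskering _ _).obj (DGL.ab ⋙ (hoHom M t).rightOp)).obj A ≅
      (cosimplicialSimplicialEquiv (ModuleCat.{u} ℚ)).functor.obj
        (op (Functor.rightOp (((SimplicialObject.whiskering _ _).obj DGL.ab).obj A) ⋙ hoHom M t)) :=
  NatIso.ofComponents (fun _ => Iso.refl _) fun _ =>
    (Category.comp_id _).trans (Category.id_comp _).symm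

end

/-- Both injections are isomorphisms, obtained from `H(L') ≅ H(H(L)) ≅ H(L)` and the resulting
homotopy equivalences. -/
theorem mainTheorem6 (L L' : DGL.{u}) (hL' : DGL.WeaklyEquivalent L' L.homologyDGL)
    (A A' : SimplicialObject DGL.{u})
    (ε : A ⟶ (SimplicialObject.const DGL.{u}).obj L)
    (ε' : A' ⟶ (SimplicialObject.const DGL.{u}).obj L')
    (hA : DGL.IsFreeResolution ε) (hA' : DGL.IsFreeResolution ε') :
    (∀ n t : ℕ, ∃ f : DGL.bigradedHomology A n t →ₗ[ℚ] DGL.bigradedHomology A' n t,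
      Function.Injective f) ∧
    (∀ (M : RatComplex.{u}) (n : ℕ) (t : ℤ),
      ∃ f : DGL.bigradedCohomology A M n t →ₗ[ℚ] DGL.bigradedCohomology A' M n t,
        Function.Injective f) := by
  obtain ⟨a⟩ := hL'.nonempty_homologyDGL_iso
  obtain ⟨b⟩ := DGL.nonempty_homologyDGL_homologyDGL_iso L
  have e := a ≪≫ b
  refine ⟨fun n t => ?_, fun M n t => ?_⟩
  · obtain ⟨E⟩ := FreeDGL.nonempty_homotopyEquiv (FreeDGL.invariant_ab_homology t) e hA hA'
    let i : DGL.bigradedHomology A n t ≅ DGL.bigradedHomology A' n t := E.toHomologyIso n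
    exact ⟨i.toLinearEquiv.toLinearMap, i.toLinearEquiv.injective⟩
  · obtain ⟨E⟩ := FreeDGL.nonempty_homotopyEquiv (FreeDGL.invariant_ab_hoHom M t) e hA hA'
    let i : DGL.bigradedCohomology A M n t ≅ DGL.bigradedCohomology A' M n t :=
      alternatingCofaceMapComplexHomologyIso _ _ (cosimplicialHoHomIso A M t) n ≪≫
        (E.toHomologyIso n).symm.unop ≪≫
        (alternatingCofaceMapComplexHomologyIso _ _ (cosimplicialHoHomIso A' M t) n).symm
    exact ⟨i.toLinearEquiv.toLinearMap, i.toLinearEquiv.injective⟩
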